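/- **Setting.** For a smooth manifold $N$ and $k\in\mathbb N$, let $N^{(k)}$ be the space $N$ with the sheaf of $\mathbb C$-algebras $U\mapsto \mathrm C^\infty(U)[[y_1,\dots,y_k]]$ (complex-valued smooth functions). A *formal manifold* is a locally ringed space $(M,\mathcal O)$ over $\mathrm{Spec}(\mathbb C)$ such that $M$ is paracompact and Hausdorff and every point of $M$ has an open neighborhood $U$ with $(U,\mathcal O|_U)\cong(\mathbb R^n)^{(k)}$ for some $n,k\in\mathbb N$ (which may depend on the point). All residue fields of $M$ are $\mathbb C$; for $f\in\mathcal O(U)$ and $a\in U$ let $f(a)\in\mathbb C$ be the value of $f$ at $a$. Let $\underline{\mathcal O}$ be the quotient of $\mathcal O$ by the ideal sheaf of the sections all of whose values vanish. Then $\underline M=(M,\underline{\mathcal O})$ is a smooth manifold, the *reduction* of $M$. Let $\underline{\mathcal D}$ be the sheaf of complex-valued smooth densities on $\underline M$. Both $\underline{\mathcal O}$ and $\underline{\mathcal D}$ are $\mathcal O$-modules. An LCS is a locally convex topological vector space over $\mathbb C$. Let $\mathcal F,\mathcal F_1,\mathcal F_2$ be $\mathcal O$-modules and $U\subseteq M$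 open. A $\mathbb C$-linear sheaf homomorphism $D:\mathcal F_1|_U\to\mathcal F_2|_U$ is a differential operator of order $\le r$ if, for all open $V\subseteq U$ and $f_0,\dots,f_r\in\mathcal O(V)$, the iterated commutator $[\dots[[D_V,f_0],f_1],\dots,f_r]$ vanishes; it is of finite order if this holds for some $r$, and it is a differential operator if it is locally of finite order. Let $\mathrm{Diff}_{\mathrm{fin}}$ be the space of those of finite order, $\mathrm{Diff}_c$ the space of differential operators with compact support in $U$ and, for $K\subseteq U$ compact and $r\in\mathbb N$, let $\mathrm{Diff}_{K,r}$ be the space of those of order $\le r$ that are supported in $K$. Put $$\rho_U:\mathrm{Diff}_c(\mathcal F|_U,\underline{\mathcal D}|_U)\to\mathrm{Hom}_{\mathbb C}(\mathcal F(U),\mathbb C),\qquad \rho_U(D)(u)=\int_U D(u),$$ $\mathrm D^\infty_c(U;\mathcal F)=\rho_U(\mathrm{Diff}_c(\mathcal F|_U,\underline{\mathcal D}|_U))$ and $\mathrm D^\infty_{K,r}(U;\mathcal F)=\rho_U(\mathrm{Diff}_{K,r}(\mathcal F|_U,\underline{\mathcal D}|_U))$. The space $\mathrm{Diff}_{\mathrm{fin}}(\mathcal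 F|_U,\underline{\mathcal D}|_U)$ has the topology defined by the seminorms $D\mapsto\sup_{a\in U}|((X\circ D)(u))(a)|$, where $X\in\mathrm{Diff}_c(\underline{\mathcal D}|_U,\underline{\mathcal O}|_U)$ and $u\in\mathcal F(U)$; $\mathrm{Diff}_{K,r}(\mathcal F|_U,\underline{\mathcal D}|_U)$ has the subspace topology and $\mathrm D^\infty_{K,r}(U;\mathcal F)$ the quotient topology. Finally $$\mathrm D^\infty_c(U;\mathcal F)=\varinjlim_{(K,r)}\mathrm D^\infty_{K,r}(U;\mathcal F)$$ has the inductive limit topology in the category of LCS, where $(K,r)$ runs over the pairs of a compact set $K\subseteq U$ and $r\in\mathbb N$, ordered by $(K,r)\preceq(K',r')$ iff $K\subseteq K'$ and $r\le r'$. For an LCS $E$ let $\mathrm C^{-\infty}(U;\mathcal F;E)$ be the space of continuous linear maps $\mathrm D^\infty_c(U;\mathcal F)\to E$ with the topology of uniform convergence on bounded sets. The extension map $\mathrm{ext}_{M,U}:\mathrm D^\infty_c(U;\mathcal F)\to\mathrm D^\infty_c(M;\mathcal F)$ sends $\eta$ to its composition with the restriction map $\mathcal F(M)\to\mathcal F(U)$,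 and the restriction map $\mathrm C^{-\infty}(M;\mathcal F;E)\to\mathrm C^{-\infty}(U;\mathcal F;E)$ is $u\mapsto u|_U=u\circ\mathrm{ext}_{M,U}$. An inductive limit $\varinjlim_i E_i$ of LCS over a directed set is *regular* if all the maps $E_i\to E_j$ ($i\le j$) are linear topological embeddings and every bounded subset of the limit is contained and bounded in some $E_i$. **Proposition.** Let $(M,\mathcal O)$ be a formal manifold, $\mathcal F$ a sheaf of $\mathcal O$-modules, and $E$ a quasi-complete Hausdorff LCS. Suppose that the inductive limit $\varinjlim_{(K,r)}\mathrm D^\infty_{K,r}(M;\mathcal F)$ is regular. Then for every open cover $\{U_\gamma\}_{\gamma\in\Gamma}$ of $M$, the maps $\mathrm{ext}_{M,U_\gamma}$ and the restriction maps are well defined, and the linear map $$\mathrm C^{-\infty}(M;\mathcal F;E)\to\prod_{\gamma\in\Gamma}\mathrm C^{-\infty}(U_\gamma;\mathcal F;E),\qquad u\mapsto\{u|_{U_\gamma}\}_{\gamma\in\Gamma},$$ is continuous and is a closed topological embedding. -/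

import Mathlib

open CategoryTheory AlgebraicGeometry TopologicalSpace Opposite Set Topology
open scoped ContDiff

universe u v w

noncomputable section

namespace FormalMfd

/-! ### Locally ringed spaces over `Spec ℂ` -/

/-- A locally ringed space over `Spec ℂ`. -/
structure LRSpaceC where
  /-- the underlying locally ringed space -/
  X : LocallyRingedSpace.{u}
  /-- the structure morphism to `Spec ℂ` -/
  str : X ⟶ Spec.locallyRingedSpaceObj (CommRingCat.of (ULift.{u} ℂ))

namespace LRSpaceC

variable (M : LRSpaceC.{u})

/-- The underlying set of points. -/
abbrev Pt : Type u := M.X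

/-- `𝒪(U)`. -/
abbrev O (U : Opens M.Pt) : Type u := M.X.presheaf.obj (op U)

/-- The restriction map `𝒪(U) → 𝒪(V)`. -/
def resO {U V : Opens M.Pt} (h : V ≤ U) : M.O U →+* M.O V :=
  (M.X.presheaf.map (homOfLE h).op).hom

/-- The ring homomorphism `ℂ → Γ(M, 𝒪)` given by the structure morphism. -/
def cGlobal : ℂ →+* M.O ⊤ :=
  (toSpecΓ (CommRingCat.of (ULift.{u} ℂ)) ≫ LocallyRingedSpace.Γ.map M.str.op).hom.comp
    (ULift.ringEquiv (R := ℂ)).symm.toRingHom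

/-- The ring homomorphism `ℂ → 𝒪(U)`. -/
def cHom (U : Opens M.Pt) : ℂ →+* M.O U :=
  (M.resO (le_top : U ≤ ⊤)).comp M.cGlobal

instance (U : Opens M.Pt) : Algebra ℂ (M.O U) := (M.cHom U).toAlgebra

theorem resO_resO {U V W : Opens M.Pt} (h : V ≤ U) (h' : W ≤ V) (f : M.O U) :
    M.resO h' (M.resO h f) = M.resO (h'.trans h) f := by
  simp only [resO]
  rw [← CommRingCat.comp_apply, ← M.X.presheaf.map_comp]
  rfl

theorem resO_self {U : Opens M.Pt} (h : U ≤ U) (f : M.O U) : M.resO h f = f := by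
  simp only [resO]
  rw [show (homOfLE h).op = 𝟙 _ from rfl, M.X.presheaf.map_id]
  rfl

theorem resO_cHom {U V : Opens M.Pt} (h : V ≤ U) (c : ℂ) :
    M.resO h (M.cHom U c) = M.cHom V c := by
  simp only [cHom, RingHom.comp_apply, resO_resO]

end LRSpaceC

/-! ### The model spaces `(ℝⁿ)^{(k)}` and formal manifolds -/

/-- `ℝⁿ`. -/
abbrev RN (n : ℕ) : Type := EuclideanSpace ℝ (Fin n)

/-- The `ℂ`-algebra `C^∞(W)` of complex-valued smooth functions on an open subset `W` of `ℝⁿ`. -/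
def SmoothFun {n : ℕ} (W : Opens (RN n)) : Subalgebra ℂ (W → ℂ) where
  carrier := {f | ∃ g : RN n → ℂ, ContDiffOn ℝ ∞ g W ∧ ∀ x : W, f x = g x}
  mul_mem' := by
    rintro f f' ⟨g, hg, h⟩ ⟨g', hg', h'⟩
    exact ⟨fun x => g x * g' x, hg.mul hg', fun x => by simp [h, h']⟩
  add_mem' := by
    rintro f f' ⟨g, hg, h⟩ ⟨g', hg', h'⟩
    exact ⟨fun x => g x + g' x, hg.add hg', fun x => by simp [h, h']⟩
  algebraMap_mem' c := ⟨fun _ => c, contDiffOn_const, fun x => rfl⟩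

/-- Restriction of smooth functions. -/
def SmoothFun.res {n : ℕ} {W W' : Opens (RN n)} (h : W' ≤ W) : SmoothFun W →ₐ[ℂ] SmoothFun W' where
  toFun f := ⟨fun x => f.1 ⟨x.1, h x.2⟩, by
    obtain ⟨g, hg, hfg⟩ := f.2
    exact ⟨g, hg.mono h, fun x => hfg _⟩⟩
  map_one' := rfl
  map_mul' _ _ := rfl
  map_zero' := rfl
  map_add' _ _ := rfl
  commutes' _ := rfl

/-- The sections `C^∞(W)[[y₁, …, y_k]]` of the structure sheaf of `(ℝⁿ)^{(k)}`. -/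
abbrev ModelO {n : ℕ} (k : ℕ) (W : Opens (RN n)) : Type :=
  MvPowerSeries (Fin k) (SmoothFun W)

/-- Restriction in the structure sheaf of `(ℝⁿ)^{(k)}`: it acts on the coefficients. -/
def ModelO.res {n k : ℕ} {W W' : Opens (RN n)} (h : W' ≤ W) : ModelO k W →+* ModelO k W' :=
  MvPowerSeries.map (SmoothFun.res h).toRingHom

/-- The open subset of `M` corresponding under `e` to an open subset of `ℝⁿ`. -/
def chartPre {M : LRSpaceC.{u}} {n : ℕ} (e : OpenPartialHomeomorph M.Pt (RN n))
    (W : Opens (RN n)) : Opens M.Pt :=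
  ⟨e.source ∩ e ⁻¹' W, e.isOpen_inter_preimage W.isOpen⟩

theorem chartPre_mono {M : LRSpaceC.{u}} {n : ℕ} (e : OpenPartialHomeomorph M.Pt (RN n))
    {W W' : Opens (RN n)} (h : W' ≤ W) : chartPre e W' ≤ chartPre e W :=
  fun _ hx => ⟨hx.1, h hx.2⟩

/-- A formal chart of dimension `n`: an open subset `U` (the source of `e`), a homeomorphism `e`
from `U` onto `ℝⁿ`, a degree `k`, and an isomorphism over `e` of sheaves of `ℂ`-algebras between the
structure sheaf of `(ℝⁿ)^{(k)}` and `𝒪|_U`. Thus this is an isomorphism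
`(U, 𝒪|_U) ≅ (ℝⁿ)^{(k)}` of locally ringed spaces over `Spec ℂ`. -/
structure FormalChart (M : LRSpaceC.{u}) (n : ℕ) where
  /-- the degree -/
  k : ℕ
  /-- the underlying homeomorphism -/
  e : OpenPartialHomeomorph M.Pt (RN n)
  target_eq : e.target = univ
  /-- the isomorphism on sections over the open set corresponding to `W ⊆ ℝⁿ` -/
  iso : ∀ W : Opens (RN n), ModelO k W ≃ₐ[ℂ] M.O (chartPre e W)
  iso_res : ∀ (W W' : Opens (RN n)) (h : W' ≤ W) (f : ModelO k W),
    iso W' (ModelO.res h f) = M.resO (chartPre_mono e h) (iso W f)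

/-- A formal manifold: a locally ringed space over `Spec ℂ` whose underlying space is paracompact and
Hausdorff, and which is locally isomorphic to `(ℝⁿ)^{(k)}` with `n, k` depending on the point. -/
structure FormalManifold extends LRSpaceC.{u} where
  t2 : T2Space X
  paracompact : ParacompactSpace X
  exists_chart : ∀ a : X, ∃ (n : ℕ) (φ : FormalChart toLRSpaceC n), a ∈ φ.e.source

attribute [instance] FormalManifold.t2 FormalManifold.paracompact

namespace FormalChart

variable {M : LRSpaceC.{u}} {n : ℕ} (φ : FormalChart M n)

theorem continuous_symm : Continuous φ.e.symm := by
  rw [← continuousOn_univ, ← φ.target_eq]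
  exact φ.e.continuousOn_symm

/-- The open subset of `ℝⁿ` corresponding to an open subset of `M`. -/
def img (V : Opens M.Pt) : Opens (RN n) :=
  ⟨φ.e.symm ⁻¹' V, V.isOpen.preimage φ.continuous_symm⟩

theorem mem_target (x : RN n) : x ∈ φ.e.target := by rw [φ.target_eq]; trivial

theorem symm_mem_source (x : RN n) : φ.e.symm x ∈ φ.e.source := φ.e.map_target (φ.mem_target x)

theorem e_symm (x : RN n) : φ.e (φ.e.symm x) = x := φ.e.right_inv (φ.mem_target x)

theorem pre_img_le (V : Opens M.Pt) : chartPre φ.e (φ.img V) ≤ V := by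
  rintro a ⟨h1, h2⟩
  have h3 : φ.e.symm (φ.e a) ∈ V := h2
  rwa [φ.e.left_inv h1] at h3

theorem mem_pre_img {V : Opens M.Pt} {a : M.Pt} (ha : a ∈ V) (ha' : a ∈ φ.e.source) :
    a ∈ chartPre φ.e (φ.img V) := by
  refine ⟨ha', ?_⟩
  show φ.e.symm (φ.e a) ∈ V
  rwa [φ.e.left_inv ha']

end FormalChart

/-! ### Values of formal functions -/

namespace LRSpaceC

variable (M : LRSpaceC.{u})

/-- The homomorphism from `ℂ` to the residue field at `a`. -/
def cResidue (a : M.Pt) : ℂ →+* M.X.residueField a :=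
  (M.X.Γevaluation a).hom.comp M.cGlobal

theorem evaluation_resO {U V : Opens M.Pt} (h : V ≤ U) (f : M.O U) {a : M.Pt} (ha : a ∈ V) :
    M.X.evaluation ⟨a, ha⟩ (M.resO h f) = M.X.evaluation ⟨a, h ha⟩ f := by
  simp only [LocallyRingedSpace.evaluation, resO, CommRingCat.comp_apply]
  congr 1
  exact TopCat.Presheaf.germ_res_apply M.X.presheaf (homOfLE h) a ha f

theorem evaluation_cHom {U : Opens M.Pt} {a : M.Pt} (ha : a ∈ U) (c : ℂ) :
    M.X.evaluation ⟨a, ha⟩ (M.cHom U c) = M.cResidue a c :=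
  M.evaluation_resO le_top (M.cGlobal c) ha

theorem evaluation_iso {n : ℕ} (φ : FormalChart M n) (W : Opens (RN n)) (F : ModelO φ.k W)
    {a : M.Pt} (ha : a ∈ chartPre φ.e W) :
    M.X.evaluation ⟨a, ha⟩ (φ.iso W F) =
      M.cResidue a ((MvPowerSeries.constantCoeff F).1 ⟨φ.e a, ha.2⟩) := by
  set c : ℂ := (MvPowerSeries.constantCoeff F).1 ⟨φ.e a, ha.2⟩ with hc
  have key : M.X.evaluation ⟨a, ha⟩ (φ.iso W (F - algebraMap ℂ _ c)) = 0 := by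
    by_contra hne
    set f := φ.iso W (F - algebraMap ℂ _ c) with hf
    have hmem : a ∈ M.X.toRingedSpace.basicOpen f :=
      (M.X.evaluation_ne_zero_iff_mem_basicOpen ⟨a, ha⟩ f).1 hne
    have hle : M.X.toRingedSpace.basicOpen f ≤ chartPre φ.e W := M.X.toRingedSpace.basicOpen_le f
    have hunit : IsUnit (M.resO hle f) := M.X.toRingedSpace.isUnit_res_basicOpen f
    set V := M.X.toRingedSpace.basicOpen f with hV
    have hW : φ.img V ≤ W := by
      intro x hx
      have h1 : φ.e.symm x ∈ chartPre φ.e W := hle hx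
      have h2 : φ.e (φ.e.symm x) ∈ W := h1.2
      rwa [φ.e_symm] at h2
    have h1 : IsUnit (M.resO (φ.pre_img_le V) (M.resO hle f)) := hunit.map _
    rw [resO_resO] at h1
    have h2 : M.resO ((φ.pre_img_le V).trans hle) f =
        φ.iso _ (ModelO.res hW (F - algebraMap ℂ _ c)) := (φ.iso_res W _ hW _).symm
    rw [h2] at h1
    have h3 : IsUnit (ModelO.res hW (F - algebraMap ℂ _ c)) := by
      have := h1.map (φ.iso (φ.img V)).symm
      rwa [AlgEquiv.symm_apply_apply] at this
    have h4 := h3.map (MvPowerSeries.constantCoeff (σ := Fin φ.k) (R := SmoothFun (φ.img V)))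
    have h5 := (h4.map (SmoothFun (φ.img V)).val).map
      (Pi.evalRingHom (fun _ : φ.img V => ℂ) ⟨φ.e a, (φ.mem_pre_img hmem ha.1).2⟩)
    refine h5.ne_zero ?_
    simp only [ModelO.res, MvPowerSeries.constantCoeff_map, map_sub]
    have h6 : MvPowerSeries.constantCoeff (algebraMap ℂ (ModelO φ.k W) c) =
        algebraMap ℂ (SmoothFun W) c := by
      rw [MvPowerSeries.algebraMap_apply, MvPowerSeries.constantCoeff_C]
    rw [h6]
    exact sub_self c
  rw [map_sub, map_sub, sub_eq_zero] at key
  rw [key, AlgEquiv.commutes]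
  exact M.evaluation_cHom ha c

end LRSpaceC

namespace FormalManifold

variable (M : FormalManifold.{u})

theorem cResidue_bijective (a : M.Pt) : Function.Bijective (M.cResidue a) := by
  refine ⟨(M.cResidue a).injective, fun r => ?_⟩
  obtain ⟨s, rfl⟩ := M.X.residue_surjective a r
  obtain ⟨V, ha, f, rfl⟩ := TopCat.Presheaf.exists_germ_eq M.X.presheaf s
  obtain ⟨n, φ, hφ⟩ := M.exists_chart a
  have h1 : M.X.residue a (M.X.presheaf.germ V a ha f) = M.X.evaluation ⟨a, ha⟩ f := rfl
  have hmem := φ.mem_pre_img ha hφ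
  refine ⟨_, (M.evaluation_iso φ (φ.img V) ((φ.iso _).symm (M.resO (φ.pre_img_le V) f)) hmem).symm.trans ?_⟩
  rw [h1, AlgEquiv.apply_symm_apply]
  exact M.evaluation_resO _ f hmem

/-- The residue field at every point is `ℂ`. -/
def residueEquiv (a : M.Pt) : ℂ ≃+* M.X.residueField a :=
  RingEquiv.ofBijective (M.cResidue a) (M.cResidue_bijective a)

/-- The value `f(a) ∈ ℂ` of a formal function `f ∈ 𝒪(U)` at a point `a ∈ U`, that is, its image in the
residue field at `a`; it is set to be `0` if `a ∉ U`. -/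
def value {U : Opens M.Pt} (f : M.O U) (a : M.Pt) : ℂ :=
  open Classical in
  if h : a ∈ U then (M.residueEquiv a).symm (M.X.evaluation ⟨a, h⟩ f) else 0

theorem value_of_notMem {U : Opens M.Pt} (f : M.O U) {a : M.Pt} (ha : a ∉ U) : M.value f a = 0 :=
  dif_neg ha

theorem value_of_mem {U : Opens M.Pt} (f : M.O U) {a : M.Pt} (ha : a ∈ U) :
    M.value f a = (M.residueEquiv a).symm (M.X.evaluation ⟨a, ha⟩ f) :=
  dif_pos ha

theorem value_add {U : Opens M.Pt} (f g : M.O U) (a : M.Pt) :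
    M.value (f + g) a = M.value f a + M.value g a := by
  by_cases ha : a ∈ U
  · simp [value_of_mem, ha]
  · simp [value_of_notMem, ha]

theorem value_mul {U : Opens M.Pt} (f g : M.O U) (a : M.Pt) :
    M.value (f * g) a = M.value f a * M.value g a := by
  by_cases ha : a ∈ U
  · simp [value_of_mem, ha]
  · simp [value_of_notMem, ha]

theorem value_one {U : Opens M.Pt} {a : M.Pt} (ha : a ∈ U) : M.value (1 : M.O U) a = 1 := by
  simp [value_of_mem, ha]

theorem value_zero {U : Opens M.Pt} (a : M.Pt) : M.value (0 : M.O U) a = 0 := by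
  by_cases ha : a ∈ U
  · simp [value_of_mem, ha]
  · simp [value_of_notMem, ha]

theorem value_cHom {U : Opens M.Pt} {a : M.Pt} (ha : a ∈ U) (c : ℂ) :
    M.value (M.cHom U c) a = c := by
  rw [value_of_mem _ _ ha, M.evaluation_cHom ha]
  exact (M.residueEquiv a).symm_apply_apply c

theorem value_resO {U V : Opens M.Pt} (h : V ≤ U) (f : M.O U) {a : M.Pt} (ha : a ∈ V) :
    M.value (M.resO h f) a = M.value f a := by
  rw [value_of_mem _ _ ha, value_of_mem _ _ (h ha), M.evaluation_resO]

theorem contDiffOn_value {n : ℕ} (φ : FormalChart M.toLRSpaceC n) {U : Opens M.Pt} (f : M.O U) :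
    ContDiffOn ℝ ∞ (fun x => M.value f (φ.e.symm x)) (φ.e.symm ⁻¹' U) := by
  set F := (φ.iso _).symm (M.resO (φ.pre_img_le U) f) with hF
  obtain ⟨g, hg, hFg⟩ := (MvPowerSeries.constantCoeff F).2
  refine ContDiffOn.congr (f := g) hg fun x hx => ?_
  have hmem : φ.e.symm x ∈ chartPre φ.e (φ.img U) := φ.mem_pre_img hx (φ.symm_mem_source x)
  have h1 := M.evaluation_iso φ _ F hmem
  rw [hF, AlgEquiv.apply_symm_apply] at h1
  have h2 : M.value f (φ.e.symm x) = _ :=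
    (M.value_resO (φ.pre_img_le U) f hmem).symm.trans (M.value_of_mem _ hmem)
  rw [h2]
  have h3 : (M.residueEquiv (φ.e.symm x)).symm
      (M.cResidue _ ((MvPowerSeries.constantCoeff F).1 ⟨φ.e (φ.e.symm x), hmem.2⟩)) =
      (MvPowerSeries.constantCoeff F).1 ⟨φ.e (φ.e.symm x), hmem.2⟩ :=
    (M.residueEquiv (φ.e.symm x)).symm_apply_apply _
  rw [h1, h3, hFg]
  simp only [φ.e_symm]

end FormalManifold

/-! ### (Pre)sheaves of `𝒪`-modules and their sections -/

namespace FormalManifold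

variable (M : FormalManifold.{u})

/-- The structure sheaf as a sheaf of rings. -/
abbrev ringSheaf : TopCat.Sheaf RingCat.{u} M.X.toTopCat :=
  (sheafCompose _ (forget₂ CommRingCat RingCat.{u})).obj M.X.sheaf

/-- Presheaves of `𝒪`-modules. -/
abbrev PMod : Type (u + 1) := PresheafOfModules.{u} M.ringSheaf.obj

/-- Sheaves of `𝒪`-modules. -/
abbrev Mod : Type (u + 1) := SheafOfModules.{u} M.ringSheaf

variable {M}

/-- The sections `P(U)`. -/
def Sec (P : M.PMod) (U : Opens M.Pt) : Type u := P.obj (op U)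

namespace Sec

variable (P : M.PMod)

instance (U : Opens M.Pt) : AddCommGroup (Sec P U) :=
  inferInstanceAs (AddCommGroup (P.obj (op U)))

instance (U : Opens M.Pt) : Module (M.O U) (Sec P U) :=
  (P.obj (op U)).isModule

instance (U : Opens M.Pt) : Module ℂ (Sec P U) :=
  Module.compHom _ (M.cHom U)

theorem smul_def {U : Opens M.Pt} (c : ℂ) (s : Sec P U) : c • s = M.cHom U c • s := rfl

instance (U : Opens M.Pt) : IsScalarTower ℂ (M.O U) (Sec P U) where
  smul_assoc c f s := by
    rw [smul_def, ← mul_smul, Algebra.smul_def]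
    rfl

/-- The restriction maps of a presheaf of `𝒪`-modules. -/
def resAdd {U V : Opens M.Pt} (h : V ≤ U) : Sec P U →+ Sec P V where
  toFun s := P.map (homOfLE h).op s
  map_zero' := map_zero (P.map (homOfLE h).op).hom
  map_add' := map_add (P.map (homOfLE h).op).hom

theorem resAdd_smul {U V : Opens M.Pt} (h : V ≤ U) (f : M.O U) (s : Sec P U) :
    resAdd P h (f • s) = M.resO h f • resAdd P h s :=
  PresheafOfModules.map_smul P (homOfLE h).op f s

/-- The restriction maps of a presheaf of `𝒪`-modules, as `ℂ`-linear maps. -/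
def res {U V : Opens M.Pt} (h : V ≤ U) : Sec P U →ₗ[ℂ] Sec P V where
  toFun := resAdd P h
  map_add' := map_add _
  map_smul' c s := by
    rw [smul_def, resAdd_smul, M.resO_cHom]
    rfl

end Sec

/-! ### Differential operators -/

/-- `T : N₁ → N₂` is a differential operator of order `≤ r` between modules over a commutative
`ℂ`-algebra `A`: all its `(r + 1)`-fold commutators with multiplications by elements of `A` vanish. -/
def IsDiffOp {A : Type*} [CommRing A] [Algebra ℂ A] {N₁ N₂ : Type*}
    [AddCommGroup N₁] [Module ℂ N₁] [Module A N₁] [IsScalarTower ℂ A N₁]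
    [AddCommGroup N₂] [Module ℂ N₂] [Module A N₂] [IsScalarTower ℂ A N₂] :
    ℕ → (N₁ →ₗ[ℂ] N₂) → Prop
  | 0, T => ∀ f : A, T ∘ₗ Algebra.lsmul ℂ ℂ N₁ f - Algebra.lsmul ℂ ℂ N₂ f ∘ₗ T = 0
  | r + 1, T => ∀ f : A,
      IsDiffOp (A := A) r (T ∘ₗ Algebra.lsmul ℂ ℂ N₁ f - Algebra.lsmul ℂ ℂ N₂ f ∘ₗ T)

section IsDiffOp

variable {A : Type*} [CommRing A] [Algebra ℂ A] {N₁ N₂ : Type*}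
    [AddCommGroup N₁] [Module ℂ N₁] [Module A N₁] [IsScalarTower ℂ A N₁]
    [AddCommGroup N₂] [Module ℂ N₂] [Module A N₂] [IsScalarTower ℂ A N₂]

theorem IsDiffOp.zero (r : ℕ) : IsDiffOp (A := A) r (0 : N₁ →ₗ[ℂ] N₂) := by
  induction r with
  | zero => intro f; simp
  | succ r ih => intro f; simpa using ih

theorem IsDiffOp.add {r : ℕ} : ∀ {T T' : N₁ →ₗ[ℂ] N₂}, IsDiffOp (A := A) r T →
    IsDiffOp (A := A) r T' → IsDiffOp (A := A) r (T + T') := by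
  induction r with
  | zero =>
    intro T T' h h' f
    have := congrArg₂ (· + ·) (h f) (h' f)
    simp only [add_zero] at this
    rw [← this, LinearMap.add_comp, LinearMap.comp_add]; abel
  | succ r ih =>
    intro T T' h h' f
    have := ih (h f) (h' f)
    rw [LinearMap.add_comp, LinearMap.comp_add]
    convert this using 1; abel

theorem IsDiffOp.smul {r : ℕ} (c : ℂ) : ∀ {T : N₁ →ₗ[ℂ] N₂}, IsDiffOp (A := A) r T →
    IsDiffOp (A := A) r (c • T) := by
  induction r with
  | zero =>
    intro T h f
    have := congrArg (c • ·) (h f)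
    simpa [smul_sub, LinearMap.comp_smul, LinearMap.smul_comp] using this
  | succ r ih =>
    intro T h f
    have := ih (h f)
    simpa [smul_sub, LinearMap.comp_smul, LinearMap.smul_comp] using this

theorem IsDiffOp.succ {r : ℕ} : ∀ {T : N₁ →ₗ[ℂ] N₂}, IsDiffOp (A := A) r T →
    IsDiffOp (A := A) (r + 1) T := by
  induction r with
  | zero => intro T h f; rw [h f]; exact IsDiffOp.zero 0
  | succ r ih => intro T h f; exact ih (h f)

theorem IsDiffOp.mono {r r' : ℕ} (hr : r ≤ r') {T : N₁ →ₗ[ℂ] N₂} (h : IsDiffOp (A := A) r T) :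
    IsDiffOp (A := A) r' T := by
  induction hr with
  | refl => exact h
  | step _ ih => exact ih.succ

end IsDiffOp

/-- `Hom_ℂ(P|_U, Q|_U)`: families of `ℂ`-linear maps `P(V) → Q(V)`, for `V ⊆ U` open, that commute
with the restriction maps. -/
def SheafHom (U : Opens M.Pt) (P Q : M.PMod) :
    Submodule ℂ (∀ V : {V : Opens M.Pt // V ≤ U}, Sec P V.1 →ₗ[ℂ] Sec Q V.1) where
  carrier := {D | ∀ (V W : {V : Opens M.Pt // V ≤ U}) (h : W.1 ≤ V.1) (s : Sec P V.1),
    Sec.res Q h (D V s) = D W (Sec.res P h s)}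
  add_mem' h h' V W hWV s := by simp [h V W hWV s, h' V W hWV s]
  zero_mem' V W hWV s := by simp
  smul_mem' c D h V W hWV s := by simp [h V W hWV s]

/-- The component `D_V : P(V) → Q(V)`. -/
def component {U : Opens M.Pt} {P Q : M.PMod} (D : SheafHom U P Q) {V : Opens M.Pt} (h : V ≤ U) :
    Sec P V →ₗ[ℂ] Sec Q V := D.1 ⟨V, h⟩

/-- `D|_V` has order `≤ r`. -/
def HasOrder {U : Opens M.Pt} {P Q : M.PMod} (D : SheafHom U P Q) {V : Opens M.Pt} (hV : V ≤ U)
    (r : ℕ) : Prop :=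
  ∀ (W : Opens M.Pt) (h : W ≤ V), IsDiffOp (A := M.O W) r (component D (h.trans hV))

/-- `D` vanishes on the complement of `K`, that is, `supp D ⊆ K` when `K` is closed in `U`. -/
def SuppIn {U : Opens M.Pt} {P Q : M.PMod} (D : SheafHom U P Q) (K : Set M.Pt) : Prop :=
  ∀ (V : Opens M.Pt) (h : V ≤ U), Disjoint (V : Set M.Pt) K → component D h = 0

variable (U : Opens M.Pt) (P Q : M.PMod)

/-- `Diff_c(P|_U, Q|_U)`: differential operators (that is, homomorphisms which are locally of finite
order) with compact support in `U`. -/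
def DiffC : Submodule ℂ (SheafHom U P Q) where
  carrier := {D | (∀ a ∈ U, ∃ (V : Opens M.Pt) (h : V ≤ U) (r : ℕ), a ∈ V ∧ HasOrder D h r) ∧
    ∃ K : Set M.Pt, IsCompact K ∧ K ⊆ U ∧ SuppIn D K}
  zero_mem' := ⟨fun a ha => ⟨U, le_rfl, 0, ha, fun _ _ => IsDiffOp.zero 0⟩, ∅, isCompact_empty,
    empty_subset _, fun _ _ _ => rfl⟩
  add_mem' := by
    rintro D D' ⟨h, K, hK, hKU, hDK⟩ ⟨h', K', hK', hKU', hDK'⟩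
    refine ⟨fun a ha => ?_, K ∪ K', hK.union hK', union_subset hKU hKU', fun V hV hd => ?_⟩
    · obtain ⟨V, hV, r, haV, hr⟩ := h a ha
      obtain ⟨V', hV', r', haV', hr'⟩ := h' a ha
      exact ⟨V ⊓ V', inf_le_left.trans hV, max r r', ⟨haV, haV'⟩, fun W hW =>
        ((hr W (hW.trans inf_le_left)).mono (le_max_left _ _)).add
        ((hr' W (hW.trans inf_le_right)).mono (le_max_right _ _))⟩
    · rw [disjoint_union_right] at hd
      exact (congrArg₂ (· + ·) (hDK V hV hd.1) (hDK' V hV hd.2)).trans (add_zero _)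
  smul_mem' := by
    rintro c D ⟨h, K, hK, hKU, hDK⟩
    refine ⟨fun a ha => ?_, K, hK, hKU, fun V hV hd => ?_⟩
    · obtain ⟨V, hV, r, haV, hr⟩ := h a ha
      exact ⟨V, hV, r, haV, fun W hW => (hr W hW).smul c⟩
    · exact (congrArg (c • ·) (hDK V hV hd)).trans (smul_zero _)

/-- `Diff_fin(P|_U, Q|_U)`: differential operators of finite order. -/
def DiffFin : Submodule ℂ (SheafHom U P Q) where
  carrier := {D | ∃ r : ℕ, HasOrder D le_rfl r}
  zero_mem' := ⟨0, fun _ _ => IsDiffOp.zero 0⟩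
  add_mem' := by
    rintro D D' ⟨r, hr⟩ ⟨r', hr'⟩
    exact ⟨max r r', fun W hW => ((hr W hW).mono (le_max_left _ _)).add
        ((hr' W hW).mono (le_max_right _ _))⟩
  smul_mem' := by
    rintro c D ⟨r, hr⟩
    exact ⟨r, fun W hW => (hr W hW).smul c⟩

/-- `𝒞(U)`: the pairs `(K, r)` of a compact subset `K` of `U` and an `r ∈ ℕ`. The order is that of
the product: `(K, r) ≤ (K', r')` if and only if `K ⊆ K'` and `r ≤ r'`. -/
abbrev CIndex (U : Opens M.Pt) : Type u := {p : Set M.Pt × ℕ // IsCompact p.1 ∧ p.1 ⊆ U}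

variable {U}

/-- `Diff_{K,r}(P|_U, Q|_U)`: differential operators of order `≤ r` that are supported in `K`. -/
def DiffKr (p : CIndex U) : Submodule ℂ (SheafHom U P Q) where
  carrier := {D | HasOrder D le_rfl p.1.2 ∧ SuppIn D p.1.1}
  zero_mem' := ⟨fun _ _ => IsDiffOp.zero _, fun _ _ _ => rfl⟩
  add_mem' := by
    rintro D D' ⟨hr, hK⟩ ⟨hr', hK'⟩
    refine ⟨fun W hW => (hr W hW).add (hr' W hW), fun V hV hd => ?_⟩
    exact (congrArg₂ (· + ·) (hK V hV hd) (hK' V hV hd)).trans (add_zero _)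
  smul_mem' := by
    rintro c D ⟨hr, hK⟩
    refine ⟨fun W hW => (hr W hW).smul c, fun V hV hd => ?_⟩
    exact (congrArg (c • ·) (hK V hV hd)).trans (smul_zero _)

theorem DiffKr_le_DiffC (p : CIndex U) : DiffKr P Q p ≤ DiffC U P Q := by
  intro D hD
  exact ⟨fun _ ha => ⟨U, le_rfl, p.1.2, ha, hD.1⟩, p.1.1, p.2.1, p.2.2, hD.2⟩

theorem DiffKr_le_DiffFin (p : CIndex U) : DiffKr P Q p ≤ DiffFin U P Q := by
  intro D hD
  exact ⟨p.1.2, hD.1⟩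

theorem DiffKr_mono {p q : CIndex U} (h : p ≤ q) : DiffKr P Q p ≤ DiffKr P Q q := by
  intro D hD
  exact ⟨fun W hW => (hD.1 W hW).mono h.2, fun V hV hd => hD.2 V hV (hd.mono_right h.1)⟩

end FormalManifold

/-! ### The reduction: smooth functions and smooth densities -/

namespace FormalManifold

variable (M : FormalManifold.{u})

/-- A presheaf of `𝒪`-modules whose sections over `U` are families of complex-valued functions on `M`
that vanish outside of `U`; restriction to `V` is the multiplication by the indicator function of `V`
and `f ∈ 𝒪(U)` acts by multiplication with the function `a ↦ f(a)`. -/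
structure FunctionModule (ι : Type u) where
  /-- the sections over `U` -/
  sec : Opens M.Pt → AddSubgroup (ι → M.Pt → ℂ)
  supp : ∀ {U : Opens M.Pt} {g : ι → M.Pt → ℂ}, g ∈ sec U → ∀ i a, a ∉ U → g i a = 0
  smul_mem : ∀ {U : Opens M.Pt} {g : ι → M.Pt → ℂ} (f : M.O U), g ∈ sec U →
    (fun i a => M.value f a * g i a) ∈ sec U
  res_mem : ∀ {U V : Opens M.Pt} {g : ι → M.Pt → ℂ}, V ≤ U → g ∈ sec U →
    (fun i => (V : Set M.Pt).indicator (g i)) ∈ sec V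

namespace FunctionModule

variable {M} {ι : Type u} (S : M.FunctionModule ι)

instance (U : Opens M.Pt) : Module (M.O U) (S.sec U) where
  smul f g := ⟨fun i a => M.value f a * g.1 i a, S.smul_mem f g.2⟩
  one_smul g := by
    ext i a
    change M.value (1 : M.O U) a * g.1 i a = g.1 i a
    by_cases ha : a ∈ U
    · rw [M.value_one ha, one_mul]
    · rw [S.supp g.2 i a ha, mul_zero]
  mul_smul f f' g := by
    ext i a
    change M.value (f * f') a * g.1 i a = M.value f a * (M.value f' a * g.1 i a)
    rw [M.value_mul, mul_assoc]
  smul_zero f := by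
    ext i a
    exact mul_zero _
  smul_add f g g' := by
    ext i a
    exact mul_add _ _ _
  add_smul f f' g := by
    ext i a
    change M.value (f + f') a * g.1 i a = M.value f a * g.1 i a + M.value f' a * g.1 i a
    rw [M.value_add, add_mul]
  zero_smul g := by
    ext i a
    change M.value (0 : M.O U) a * g.1 i a = 0
    rw [M.value_zero, zero_mul]

/-- Restriction of sections. -/
def res {U V : Opens M.Pt} (h : V ≤ U) : S.sec U →+ S.sec V where
  toFun g := ⟨fun i => (V : Set M.Pt).indicator (g.1 i), S.res_mem h g.2⟩
  map_zero' := by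
    ext i a
    exact congrFun (indicator_zero' (M := ℂ)) a
  map_add' g g' := by
    ext i a
    exact congrFun (indicator_add' (V : Set M.Pt) (g.1 i) (g'.1 i)) a

/-- The underlying presheaf of abelian groups. -/
def toPresheafAb : (Opens M.Pt)ᵒᵖ ⥤ AddCommGrpCat.{u} where
  obj U := AddCommGrpCat.of (S.sec U.unop)
  map f := AddCommGrpCat.ofHom (S.res f.unop.le)
  map_id U := by
    refine AddCommGrpCat.hom_ext (AddMonoidHom.ext fun g => Subtype.ext (funext fun i => ?_))
    refine indicator_eq_self.2 fun a ha => ?_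
    by_contra h
    exact ha (S.supp g.2 i a h)
  map_comp {U V W} f f' := by
    refine AddCommGrpCat.hom_ext (AddMonoidHom.ext fun g => Subtype.ext (funext fun i => ?_))
    change (W.unop : Set M.Pt).indicator (g.1 i) =
      (W.unop : Set M.Pt).indicator ((V.unop : Set M.Pt).indicator (g.1 i))
    rw [indicator_indicator, inter_eq_left.2]
    exact f'.unop.le

instance (U : (Opens M.Pt)ᵒᵖ) : Module (M.ringSheaf.obj.obj U) (S.toPresheafAb.obj U) :=
  inferInstanceAs (Module (M.O U.unop) (S.sec U.unop))

/-- The associated presheaf of `𝒪`-modules. -/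
def toPMod : M.PMod :=
  PresheafOfModules.ofPresheaf (R := M.ringSheaf.obj) S.toPresheafAb (by
    intro U V f r g
    refine Subtype.ext (funext fun i => funext fun a => ?_)
    change (V.unop : Set M.Pt).indicator (fun a => M.value (U := U.unop) r a * g.1 i a) a =
      M.value (M.resO f.unop.le (U := U.unop) r) a * (V.unop : Set M.Pt).indicator (g.1 i) a
    by_cases ha : a ∈ V.unop
    · rw [indicator_of_mem (by exact ha), indicator_of_mem (by exact ha)]
      exact congrArg (· * g.1 i a) (M.value_resO (U := U.unop) f.unop.le r ha).symm
    · rw [indicator_of_notMem (by exact ha), indicator_of_notMem (by exact ha), mul_zero])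

/-- The family of functions underlying a section. -/
def toFun {U : Opens M.Pt} (s : Sec S.toPMod U) : ι → M.Pt → ℂ :=
  (show S.sec U from s).1

end FunctionModule

/-- The structure sheaf of the reduction of `M`, the quotient of `𝒪` by the ideal of the formal
functions whose values are all zero. A section over `U` is a complex-valued function on `U` that is
locally of the form `a ↦ f(a)` with `f` a section of `𝒪`; it is extended by zero. -/
def redFunctions : M.FunctionModule PUnit where
  sec U :=
    { carrier := {g | (∀ i, ∀ a ∉ U, g i a = 0) ∧ ∀ i, ∀ a ∈ U, ∃ (V : Opens M.Pt) (f : M.O V),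
        a ∈ V ∧ V ≤ U ∧ ∀ b ∈ V, g i b = M.value f b}
      zero_mem' := ⟨fun _ _ _ => rfl, fun _ a ha => ⟨U, 0, ha, le_rfl, fun b _ =>
        (M.value_zero b).symm⟩⟩
      add_mem' := by
        rintro g g' ⟨h1, h2⟩ ⟨h1', h2'⟩
        refine ⟨fun i a ha => by simp [h1 i a ha, h1' i a ha], fun i a ha => ?_⟩
        obtain ⟨V, f, haV, hV, hf⟩ := h2 i a ha
        obtain ⟨V', f', haV', hV', hf'⟩ := h2' i a ha
        refine ⟨V ⊓ V', M.resO inf_le_left f + M.resO inf_le_right f', ⟨haV, haV'⟩,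
          inf_le_left.trans hV, fun b hb => ?_⟩
        rw [M.value_add, M.value_resO _ _ hb, M.value_resO _ _ hb, ← hf b hb.1, ← hf' b hb.2]
        rfl
      neg_mem' := by
        rintro g ⟨h1, h2⟩
        refine ⟨fun i a ha => by simp [h1 i a ha], fun i a ha => ?_⟩
        obtain ⟨V, f, haV, hV, hf⟩ := h2 i a ha
        refine ⟨V, -f, haV, hV, fun b hb => ?_⟩
        have := M.value_add f (-f) b
        rw [add_neg_cancel, M.value_zero, ← hf b hb] at this
        exact (eq_neg_of_add_eq_zero_right this.symm).symm }
  supp h i a ha := h.1 i a ha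
  smul_mem {U g} f h := by
    refine ⟨fun i a ha => by simp [h.1 i a ha], fun i a ha => ?_⟩
    obtain ⟨V, f', haV, hV, hf⟩ := h.2 i a ha
    refine ⟨V, M.resO hV f * f', haV, hV, fun b hb => ?_⟩
    rw [M.value_mul, M.value_resO _ _ hb, ← hf b hb]
  res_mem {U V g} hVU h := by
    refine ⟨fun i a ha => indicator_of_notMem (by exact ha) _, fun i a ha => ?_⟩
    obtain ⟨V', f', haV, hV, hf⟩ := h.2 i a (hVU ha)
    refine ⟨V' ⊓ V, M.resO inf_le_left f', ⟨haV, ha⟩, inf_le_right, fun b hb => ?_⟩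
    rw [M.value_resO _ _ hb, ← hf b hb.1]
    exact indicator_of_mem (by exact hb.2) _

/-- The structure sheaf of the reduction, as a presheaf of `𝒪`-modules. -/
abbrev redO : M.PMod := M.redFunctions.toPMod

/-- The charts of the reduction of `M`: those underlying the formal charts of `M`. -/
abbrev Chart : Type u := Σ n : ℕ, FormalChart M.toLRSpaceC n

variable {M} in
/-- `τ` is a smooth density on the open subset `U` of the reduction of `M`. Here `τ φ a` is the
coefficient at `a` of the density with respect to the Lebesgue density `|dx|` of the chart `φ`,
extended by zero to all `a ∈ M`. The last condition is the transformation rule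
`τ_φ = |det D(ψ ∘ φ⁻¹)| ⬝ τ_ψ`. -/
structure IsDensity (U : Opens M.Pt) (τ : M.Chart → M.Pt → ℂ) : Prop where
  supp : ∀ φ, ∀ a ∉ U, τ φ a = 0
  supp_chart : ∀ φ : M.Chart, ∀ a ∉ φ.2.e.source, τ φ a = 0
  smooth : ∀ φ : M.Chart, ContDiffOn ℝ ∞ (fun x => τ φ (φ.2.e.symm x)) (φ.2.e.symm ⁻¹' U)
  transf : ∀ (n : ℕ) (φ ψ : FormalChart M.toLRSpaceC n), ∀ a ∈ U, a ∈ φ.e.source →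
    a ∈ ψ.e.source →
    τ ⟨n, φ⟩ a = |(fderiv ℝ (ψ.e ∘ φ.e.symm) (φ.e a)).det| * τ ⟨n, ψ⟩ a

/-- The sheaf of smooth densities on the reduction. -/
def redDensities : M.FunctionModule M.Chart where
  sec U :=
    { carrier := {τ | IsDensity U τ}
      zero_mem' := ⟨fun _ _ _ => rfl, fun _ _ _ => rfl, fun _ => contDiffOn_const,
        fun _ _ _ _ _ _ _ => (mul_zero _).symm⟩
      add_mem' := fun {τ τ'} h h' => ⟨fun φ a ha => by simp [h.supp φ a ha, h'.supp φ a ha],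
        fun φ a ha => by simp [h.supp_chart φ a ha, h'.supp_chart φ a ha],
        fun φ => (h.smooth φ).add (h'.smooth φ), fun n φ ψ a ha hφ hψ => by
          simp only [Pi.add_apply]
          rw [h.transf n φ ψ a ha hφ hψ, h'.transf n φ ψ a ha hφ hψ, mul_add]⟩
      neg_mem' := fun {τ} h => ⟨fun φ a ha => by simp [h.supp φ a ha],
        fun φ a ha => by simp [h.supp_chart φ a ha],
        fun φ => (h.smooth φ).neg, fun n φ ψ a ha hφ hψ => by
          simp only [Pi.neg_apply]
          rw [h.transf n φ ψ a ha hφ hψ, mul_neg]⟩ }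
  supp h i a ha := IsDensity.supp h i a ha
  smul_mem {U τ} f h := by
    have h : IsDensity U τ := h
    refine ⟨fun φ a ha => by simp [h.supp φ a ha], fun φ a ha => by simp [h.supp_chart φ a ha],
      fun φ => (M.contDiffOn_value φ.2 f).mul (h.smooth φ), fun n φ ψ a ha hφ hψ => ?_⟩
    rw [h.transf n φ ψ a ha hφ hψ]
    ring
  res_mem {U V τ} hVU h := by
    have h : IsDensity U τ := h
    refine ⟨fun φ a ha => indicator_of_notMem (by exact ha) _, fun φ a ha => ?_, fun φ => ?_,
      fun n φ ψ a ha hφ hψ => ?_⟩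
    · exact indicator_apply_eq_zero.2 fun _ => h.supp_chart φ a ha
    · refine ((h.smooth φ).mono (preimage_mono hVU)).congr fun x hx => ?_
      exact indicator_of_mem (s := (V : Set M.Pt)) hx (τ φ)
    · rw [indicator_of_mem (by exact ha), indicator_of_mem (by exact ha)]
      exact h.transf n φ ψ a (hVU ha) hφ hψ

/-- The sheaf of smooth densities on the reduction, as a presheaf of `𝒪`-modules. -/
abbrev dens : M.PMod := M.redDensities.toPMod

end FormalManifold

/-! ### Integration of compactly supported densities -/

namespace FormalManifold

variable (M : FormalManifold.{u})

/-- A locally finite open cover `(v a)` of `M` whose members are relatively compact in the domains of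
charts `φ a`. -/
structure ChartCover where
  /-- the open sets of the cover -/
  v : M.Pt → Set M.Pt
  /-- the charts -/
  φ : M.Pt → M.Chart
  isOpen : ∀ a, IsOpen (v a)
  cover : ⋃ a, v a = univ
  locallyFinite : LocallyFinite v
  relCompact : ∀ a, ∃ C : Set M.Pt, IsCompact C ∧ v a ⊆ C ∧ C ⊆ (φ a).2.e.source

theorem nonempty_chartCover : Nonempty M.ChartCover := by
  choose n φ hφ using M.exists_chart
  obtain ⟨v, hv, hc, hf, hle⟩ := precise_refinement
    (fun a : M.Pt => (φ a).e.source ∩ (φ a).e ⁻¹' Metric.ball ((φ a).e a) 1)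
    (fun a => (φ a).e.isOpen_inter_preimage Metric.isOpen_ball)
    (iUnion_eq_univ_iff.2 fun a => ⟨a, hφ a, Metric.mem_ball_self one_pos⟩)
  refine ⟨v, fun a => ⟨n a, φ a⟩, hv, hc, hf, fun a =>
    ⟨(φ a).e.symm '' Metric.closedBall ((φ a).e a) 1,
      (isCompact_closedBall _ _).image (φ a).continuous_symm, fun b hb => ?_, ?_⟩⟩
  · obtain ⟨h1, h2⟩ := hle a hb
    exact ⟨(φ a).e b, Metric.ball_subset_closedBall h2, (φ a).e.left_inv h1⟩
  · rintro _ ⟨x, -, rfl⟩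
    exact (φ a).symm_mem_source x

/-- A chosen cover as above. -/
def chartCover : M.ChartCover := M.nonempty_chartCover.some

/-- Borel sets `B a ⊆ v a` that form a partition of `M`: the point `b` lies in `B a` for the first
`a`, with respect to a well-ordering, such that `b ∈ v a`. -/
def piece (a : M.Pt) : Set M.Pt :=
  M.chartCover.v a \ ⋃ (b : M.Pt) (_ : WellOrderingRel b a), M.chartCover.v b

variable {M} in
/-- The integral `∫_M τ` of a compactly supported smooth density `τ` on an open subset of the
reduction: `M` is partitioned into Borel sets that are relatively compact in chart domains, and the
integrals over these sets, which are computed in the charts with respect to the Lebesgue measure, are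
added up. Only finitely many terms are non-zero; by the transformation rule, the result does not
depend on the partition and the charts. -/
def integral (τ : M.Chart → M.Pt → ℂ) : ℂ :=
  ∑ᶠ a : M.Pt, ∫ x in (M.chartCover.φ a).2.e.symm ⁻¹' M.piece a,
    τ (M.chartCover.φ a) ((M.chartCover.φ a).2.e.symm x)

variable {M}

/-- `τ` is a smooth density on `U` with compact support in `U`. -/
def IsCptDensity (U : Opens M.Pt) (τ : M.Chart → M.Pt → ℂ) : Prop :=
  IsDensity U τ ∧ ∃ K : Set M.Pt, IsCompact K ∧ K ⊆ U ∧ ∀ φ, ∀ a ∉ K, τ φ a = 0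

theorem IsCptDensity.continuous {U : Opens M.Pt} {τ : M.Chart → M.Pt → ℂ} (h : IsCptDensity U τ)
    (φ : M.Chart) : Continuous fun x => τ φ (φ.2.e.symm x) := by
  obtain ⟨h, K, hK, hKU, hτ⟩ := h
  have hs := φ.2.continuous_symm
  rw [continuous_iff_continuousAt]
  intro x
  by_cases hx : φ.2.e.symm x ∈ U
  · exact (h.smooth φ).continuousOn.continuousAt ((U.isOpen.preimage hs).mem_nhds hx)
  · have hx' : φ.2.e.symm x ∈ Kᶜ := fun h => hx (hKU h)
    have hev : (fun x => τ φ (φ.2.e.symm x)) =ᶠ[𝓝 x] fun _ => 0 := by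
      filter_upwards [(hK.isClosed.isOpen_compl.preimage hs).mem_nhds hx'] with y hy
      exact hτ _ _ hy
    exact (continuousAt_const).congr hev.symm

theorem IsCptDensity.integrableOn {U : Opens M.Pt} {τ : M.Chart → M.Pt → ℂ}
    (h : IsCptDensity U τ) (a : M.Pt) :
    MeasureTheory.IntegrableOn (fun x => τ (M.chartCover.φ a) ((M.chartCover.φ a).2.e.symm x))
      ((M.chartCover.φ a).2.e.symm ⁻¹' M.piece a) := by
  obtain ⟨C, hC, hvC, hCs⟩ := M.chartCover.relCompact a
  set φ := M.chartCover.φ a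
  have hcpt : IsCompact (φ.2.e '' C) := hC.image_of_continuousOn (φ.2.e.continuousOn.mono hCs)
  refine ((h.continuous φ).continuousOn.integrableOn_compact hcpt).mono_set fun x hx => ?_
  exact ⟨φ.2.e.symm x, hvC hx.1, φ.2.e_symm x⟩

theorem IsCptDensity.finite_support {U : Opens M.Pt} {τ : M.Chart → M.Pt → ℂ}
    (h : IsCptDensity U τ) :
    (Function.support fun a : M.Pt => ∫ x in (M.chartCover.φ a).2.e.symm ⁻¹' M.piece a,
      τ (M.chartCover.φ a) ((M.chartCover.φ a).2.e.symm x)).Finite := by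
  obtain ⟨-, K, hK, -, hτ⟩ := h
  refine (M.chartCover.locallyFinite.finite_nonempty_inter_compact hK).subset fun a ha => ?_
  by_contra hne
  refine ha (MeasureTheory.setIntegral_eq_zero_of_forall_eq_zero fun x hx => hτ _ _ fun hxK => ?_)
  exact hne ⟨_, hx.1, hxK⟩

theorem integral_add {U : Opens M.Pt} {τ τ' : M.Chart → M.Pt → ℂ} (h : IsCptDensity U τ)
    (h' : IsCptDensity U τ') : integral (τ + τ') = integral τ + integral τ' := by
  unfold integral
  rw [← finsum_add_distrib h.finite_support h'.finite_support]
  refine finsum_congr fun a => ?_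
  exact MeasureTheory.integral_add (h.integrableOn a) (h'.integrableOn a)

theorem integral_smul (c : ℂ) (τ : M.Chart → M.Pt → ℂ) :
    integral (fun φ a => c * τ φ a) = c * integral τ := by
  unfold integral
  rw [mul_finsum]
  exact finsum_congr fun a => MeasureTheory.integral_const_mul _ _

/-! ### The spaces of compactly supported formal densities -/

theorem isCptDensity_apply {U : Opens M.Pt} {P : M.PMod} (D : DiffC U P M.dens) (u : Sec P U) :
    IsCptDensity U (M.redDensities.toFun (component D.1 le_rfl u)) := by
  obtain ⟨D, -, K, hK, hKU, hDK⟩ := D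
  refine ⟨(show M.redDensities.sec U from component D le_rfl u).2, K, hK, hKU, fun φ a ha => ?_⟩
  set s := component D le_rfl u
  by_cases haU : a ∈ U
  · let V : Opens M.Pt := ⟨U \ K, U.isOpen.sdiff hK.isClosed⟩
    have hV : V ≤ U := fun _ hx => hx.1
    have haV : a ∈ V := ⟨haU, ha⟩
    have h1 : Sec.res M.dens hV s = 0 := by
      have h2 := D.2 ⟨U, le_rfl⟩ ⟨V, hV⟩ hV u
      have h3 : component D hV = 0 := hDK V hV disjoint_sdiff_left
      exact h2.trans (LinearMap.congr_fun h3 _)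
    have h4 : (V : Set M.Pt).indicator (M.redDensities.toFun s φ) a = 0 :=
      congrFun (congrFun (congrArg Subtype.val h1) φ) a
    rwa [indicator_of_mem (by exact haV)] at h4
  · exact (show IsDensity U _ from (show M.redDensities.sec U from s).2).supp φ a haU

theorem toFun_smul {U : Opens M.Pt} (c : ℂ) (s : Sec M.dens U) :
    M.redDensities.toFun (c • s) = fun φ a => c * M.redDensities.toFun s φ a := by
  funext φ a
  change M.value (M.cHom U c) a * M.redDensities.toFun s φ a = _
  by_cases ha : a ∈ U
  · rw [M.value_cHom ha]
  · rw [show M.redDensities.toFun s φ a = 0 from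
      (show IsDensity U _ from (show M.redDensities.sec U from s).2).supp φ a ha, mul_zero, mul_zero]

/-- The linear map `ρ_U : Diff_c(P|_U, 𝒟|_U) → Hom_ℂ(P(U), ℂ)`, `D ↦ (u ↦ ∫_U D(u))`. -/
def rho (U : Opens M.Pt) (P : M.PMod) : DiffC U P M.dens →ₗ[ℂ] Sec P U →ₗ[ℂ] ℂ where
  toFun D :=
    { toFun u := integral (M.redDensities.toFun (component D.1 le_rfl u))
      map_add' u u' := by
        rw [map_add]
        exact integral_add (isCptDensity_apply D u) (isCptDensity_apply D u')
      map_smul' c u := by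
        rw [map_smul, toFun_smul]
        exact integral_smul _ _ }
  map_add' D D' := LinearMap.ext fun u =>
    integral_add (isCptDensity_apply D u) (isCptDensity_apply D' u)
  map_smul' c D := LinearMap.ext fun u => by
    change integral (M.redDensities.toFun (c • component D.1 le_rfl u)) = _
    rw [toFun_smul]
    exact integral_smul _ _

variable (F : M.Mod)

/-- The space `D^∞_c(U; F) = ρ_U(Diff_c(F|_U, 𝒟|_U))`. (All its elements are continuous for the smooth
topology of `F(U)`, so it does not matter whether it is seen in the algebraic or in the topological
dual of `F(U)`.) -/
def Dc (U : Opens M.Pt) : Submodule ℂ (Sec F.val U →ₗ[ℂ] ℂ) := (rho U F.val).range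

variable {U : Opens M.Pt}

/-- The restriction of `ρ_U` to `Diff_{K,r}(F|_U, 𝒟|_U)`. -/
def rhoKr (p : CIndex U) : DiffKr F.val M.dens p →ₗ[ℂ] Sec F.val U →ₗ[ℂ] ℂ :=
  rho U F.val ∘ₗ Submodule.inclusion (DiffKr_le_DiffC F.val M.dens p)

/-- The space `D^∞_{K,r}(U; F) = ρ_U(Diff_{K,r}(F|_U, 𝒟|_U))`. -/
def DKr (p : CIndex U) : Submodule ℂ (Sec F.val U →ₗ[ℂ] ℂ) := (rhoKr F p).range

theorem DKr_le_Dc (p : CIndex U) : DKr F p ≤ Dc F U := by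
  rintro _ ⟨D, rfl⟩
  exact ⟨_, rfl⟩

theorem DKr_mono {p q : CIndex U} (h : p ≤ q) : DKr F p ≤ DKr F q := by
  rintro _ ⟨D, rfl⟩
  exact ⟨Submodule.inclusion (DiffKr_mono F.val M.dens h) D, rfl⟩

/-- The topology on `Diff_fin(F|_U, 𝒟|_U)` that is defined by the seminorms
`D ↦ sup_a |((X ∘ D)(u))(a)|`, with `X ∈ Diff_c(𝒟|_U, 𝒪_red|_U)` and `u ∈ F(U)`: it is induced by the
maps `D ↦ (X ∘ D)(u)` to the functions on `M` with uniform convergence. -/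
instance : TopologicalSpace (DiffFin U F.val M.dens) :=
  ⨅ (X : DiffC U M.dens M.redO) (u : Sec F.val U), TopologicalSpace.induced
    (fun D => UniformFun.ofFun
      (M.redFunctions.toFun (component X.1 le_rfl (component D.1 le_rfl u)) PUnit.unit))
    (inferInstance : TopologicalSpace (UniformFun M.Pt ℂ))

/-- `Diff_{K,r}(F|_U, 𝒟|_U)` carries the subspace topology. -/
instance (p : CIndex U) : TopologicalSpace (DiffKr F.val M.dens p) :=
  TopologicalSpace.induced (Submodule.inclusion (DiffKr_le_DiffFin F.val M.dens p)) inferInstance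

/-- `D^∞_{K,r}(U; F)` carries the quotient topology. -/
instance (p : CIndex U) : TopologicalSpace (DKr F p) :=
  TopologicalSpace.coinduced (rhoKr F p).rangeRestrict inferInstance

/-- `D^∞_c(U; F)` carries the inductive limit topology in the category of locally convex spaces: the
finest locally convex vector space topology for which all the inclusions
`D^∞_{K,r}(U; F) → D^∞_c(U; F)` are continuous. -/
instance : TopologicalSpace (Dc F U) :=
  sInf {t | @IsTopologicalAddGroup _ t _ ∧ @ContinuousSMul ℂ _ _ _ t ∧
    @LocallyConvexSpace ℝ _ _ _ _ _ t ∧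
    ∀ p : CIndex U, @Continuous _ _ _ t (Submodule.inclusion (DKr_le_Dc F p))}

instance : IsTopologicalAddGroup (Dc F U) := topologicalAddGroup_sInf fun _ h => h.1

instance : ContinuousSMul ℂ (Dc F U) := continuousSMul_sInf fun _ h => h.2.1

instance : LocallyConvexSpace ℝ (Dc F U) := .sInf fun _ h => h.2.2.1

/-- The inductive limit `lim D^∞_{K,r}(M; F)` is regular: it is strict, which means that its
transition maps are topological embeddings, and every bounded subset of it is contained and bounded in
some `D^∞_{K,r}(M; F)`. -/
def IsRegularLimit : Prop :=
  (∀ (p q : CIndex (⊤ : Opens M.Pt)) (h : p ≤ q),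
    IsEmbedding (Submodule.inclusion (DKr_mono F h))) ∧
  ∀ B : Set (Dc F ⊤), Bornology.IsVonNBounded ℂ B →
    ∃ (p : CIndex (⊤ : Opens M.Pt)) (B' : Set (DKr F p)), Bornology.IsVonNBounded ℂ B' ∧
      Submodule.inclusion (DKr_le_Dc F p) '' B' = B

/-- `C^{-∞}(U; F; E) = ℒ_b(D^∞_c(U; F), E)`: the continuous linear maps, with the topology of uniform
convergence on bounded sets (which is the topology of `→L[ℂ]`). -/
abbrev GenFun (U : Opens M.Pt) (E : Type*) [AddCommGroup E] [Module ℂ E] [TopologicalSpace E]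
    [IsTopologicalAddGroup E] [ContinuousSMul ℂ E] : Type _ :=
  Dc F U →L[ℂ] E

variable {F} in
/-- `η' = ext_{M,U}(η)`: the functional `η' ∈ D^∞_c(M; F)` is the composition of
`η ∈ D^∞_c(U; F)` with the restriction map `F(M) → F(U)`. -/
def IsExt (η : Dc F U) (η' : Dc F (⊤ : Opens M.Pt)) : Prop :=
  ∀ s : Sec F.val (⊤ : Opens M.Pt), η'.1 s = η.1 (Sec.res F.val le_top s)

end FormalManifold

end FormalMfd

end

noncomputable section

namespace FormalMfd

/-! ### Gluing two sections -/

/-! The extension maps have local right inverses built from cutoff functions. If a formal function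
`f` has compact support in `U`, then multiplying a formal density on `M` by `f` gives a continuous
linear map `m` from `Dc F ⊤` to `Dc F U`, and extending `m η` by zero gives back the functional `u ↦
η (f • u)` (`exists_localize`). A partition of unity near a compact set `K` therefore writes every
`η` supported in `K` as a finite sum of `ext (m_γ η)`, where the `m_γ` depend on `K` only
(`exists_decomposition`).

Embedding: by regularity, a bounded set `B` of formal densities comes from a single `DKr`, hence
from a single `K`. On `B` a generalized function is thus recovered from its restrictions by `u η = ∑
u|_γ (m_γ η)`, and this expression is continuous in the family of restrictions
(`isInducing_restrictCLM`).

Closed range: a family `(v_γ)` comes from a linear map on `Dc F ⊤` iff the sum map it defines on the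
direct sum of the `Dc F (U γ)` kills the kernel of the sum of the extension maps. These are
conditions on values at points, so they are closed because `E` is Hausdorff
(`isClosed_range_restrictCLM`). The resulting linear map is automatically continuous: on each `DKr`
it is a finite sum of maps `v_γ ∘ m_γ`, and `E` is locally convex, so the universal property of the
inductive limit applies (`continuous_of_continuous_extDc`).

All continuity claims about formal densities are proved on the level of differential operators: each
seminorm of the transformed operator is shown to be a seminorm of the original one. -/

theorem exists_glue₂ {C : Type*} [Category* C] {FC : C → C → Type*} {CC : C → Type u}
    [∀ X Y, FunLike (FC X Y) (CC X) (CC Y)] [ConcreteCategory.{u} C FC]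
    [Limits.HasLimitsOfSize.{u, u} C] [(CategoryTheory.forget C).ReflectsIsomorphisms]
    [Limits.PreservesLimitsOfSize.{u, u} (CategoryTheory.forget C)]
    {X : TopCat.{u}} (F : TopCat.Sheaf C X) {U₁ U₂ V : Opens X} (h₁ : U₁ ≤ V) (h₂ : U₂ ≤ V)
    (hV : V ≤ U₁ ⊔ U₂) (s₁ : ToType (F.1.obj (op U₁))) (s₂ : ToType (F.1.obj (op U₂)))
    (h : F.1.map (homOfLE (inf_le_left : U₁ ⊓ U₂ ≤ U₁)).op s₁ =
      F.1.map (homOfLE (inf_le_right : U₁ ⊓ U₂ ≤ U₂)).op s₂) :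
    ∃ s : ToType (F.1.obj (op V)), F.1.map (homOfLE h₁).op s = s₁ ∧
      F.1.map (homOfLE h₂).op s = s₂ := by
  let W : Bool → Opens X := fun i => Bool.rec U₂ U₁ i
  let sf : ∀ i, ToType (F.1.obj (op (W i))) := fun i => Bool.rec s₂ s₁ i
  have hW : ∀ i, W i ≤ V := fun i => Bool.rec h₂ h₁ i
  have hle : V ≤ iSup W := hV.trans (sup_le (le_iSup W true) (le_iSup W false))
  obtain ⟨s, hs, -⟩ := F.existsUnique_gluing' W V (fun i => homOfLE (hW i)) hle sf (by
    rintro (_ | _) (_ | _)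
    · rfl
    · have h' := congrArg (F.1.map (homOfLE (inf_comm U₂ U₁).le).op) h
      rw [← ConcreteCategory.comp_apply, ← ConcreteCategory.comp_apply, ← F.1.map_comp,
        ← F.1.map_comp] at h'
      exact h'.symm
    · exact h
    · rfl)
  exact ⟨s, hs true, hs false⟩

namespace FormalManifold

variable {M : FormalManifold.{u}}

/-! ### Partitions of unity -/

/-- The global formal function `f` vanishes outside of `C`. -/
def VanishesOff (f : M.O ⊤) (C : Set M.Pt) : Prop :=
  ∀ V : Opens M.Pt, Disjoint (V : Set M.Pt) C → M.resO (le_top : V ≤ ⊤) f = 0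

theorem VanishesOff.mono {f : M.O ⊤} {C C' : Set M.Pt} (h : VanishesOff f C) (hC : C ⊆ C') :
    VanishesOff f C' :=
  fun V hV => h V (hV.mono_right hC)

theorem VanishesOff.add {f g : M.O ⊤} {C : Set M.Pt} (hf : VanishesOff f C)
    (hg : VanishesOff g C) : VanishesOff (f + g) C := fun V hV => by
  rw [map_add, hf V hV, hg V hV, add_zero]

theorem VanishesOff.mul_left {f : M.O ⊤} {C : Set M.Pt} (g : M.O ⊤) (hf : VanishesOff f C) :
    VanishesOff (g * f) C := fun V hV => by
  rw [map_mul, hf V hV, mul_zero]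

theorem VanishesOff.zero (C : Set M.Pt) : VanishesOff (0 : M.O ⊤) C := fun _ _ => map_zero _

/-- The global formal function `f` is equal to `1` on a neighborhood of `K`. -/
def EqOneNear (f : M.O ⊤) (K : Set M.Pt) : Prop :=
  ∃ W : Opens M.Pt, K ⊆ W ∧ M.resO (le_top : W ≤ ⊤) f = 1

theorem EqOneNear.mono {f : M.O ⊤} {K K' : Set M.Pt} (h : EqOneNear f K') (hK : K ⊆ K') :
    EqOneNear f K :=
  h.imp fun _ h => ⟨hK.trans h.1, h.2⟩

theorem exists_glueO {U₁ U₂ V : Opens M.Pt} (h₁ : U₁ ≤ V) (h₂ : U₂ ≤ V) (hV : V ≤ U₁ ⊔ U₂)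
    (s₁ : M.O U₁) (s₂ : M.O U₂) (h : M.resO (inf_le_left : U₁ ⊓ U₂ ≤ U₁) s₁ =
      M.resO (inf_le_right : U₁ ⊓ U₂ ≤ U₂) s₂) :
    ∃ s : M.O V, M.resO h₁ s = s₁ ∧ M.resO h₂ s = s₂ :=
  exists_glue₂ M.X.sheaf h₁ h₂ hV s₁ s₂ h

theorem resO_sup_eq {V W : Opens M.Pt} {f g : M.O ⊤}
    (hV : M.resO (le_top : V ≤ ⊤) f = M.resO le_top g)
    (hW : M.resO (le_top : W ≤ ⊤) f = M.resO le_top g) :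
    M.resO (le_top : V ⊔ W ≤ ⊤) f = M.resO le_top g := by
  refine M.X.sheaf.eq_of_locally_eq₂ (homOfLE le_sup_left) (homOfLE le_sup_right) le_rfl _ _ ?_ ?_
  · exact (M.resO_resO le_top le_sup_left f).trans
      (hV.trans (M.resO_resO le_top le_sup_left g).symm)
  · exact (M.resO_resO le_top le_sup_right f).trans
      (hW.trans (M.resO_resO le_top le_sup_right g).symm)

/-- In a chart, a smooth bump function is viewed as a constant power series. It vanishes outside a
compact set `C`, which is closed since `M` is Hausdorff, so it glues with the zero section on the
complement of `C`. -/
theorem exists_bump {U : Opens M.Pt} {a : M.Pt} (ha : a ∈ U) :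
    ∃ (f : M.O ⊤) (C : Set M.Pt), IsCompact C ∧ C ⊆ U ∧ VanishesOff f C ∧
      EqOneNear f {a} := by
  obtain ⟨n, φ, hφ⟩ := M.exists_chart a
  obtain ⟨ε, hε, hball⟩ := Metric.isOpen_iff.1 (φ.img U).isOpen (φ.e a) (φ.mem_pre_img ha hφ).2
  -- The closed ball of radius `ε / 2` lies in the ball of radius `ε`, hence in the image of `U`;
  -- the bump is `1` on the ball of radius `ε / 4`.
  let b : ContDiffBump (φ.e a) := ⟨ε / 4, ε / 2, by positivity, by linarith⟩
  let C : Set M.Pt := φ.e.symm '' Metric.closedBall (φ.e a) (ε / 2)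
  have hC : IsCompact C := (isCompact_closedBall _ _).image φ.continuous_symm
  have hCU : C ⊆ U := by
    rintro _ ⟨x, hx, rfl⟩
    exact hball (Metric.closedBall_subset_ball (by linarith) hx)
  let g : SmoothFun (⊤ : Opens (RN n)) := ⟨fun x => (b x.1 : ℂ), fun x => (b x : ℂ),
    (Complex.ofRealCLM.contDiff.comp b.contDiff).contDiffOn, fun _ => rfl⟩
  let s := φ.iso ⊤ (MvPowerSeries.C g)
  have hs : ∀ W : Opens (RN n), M.resO (chartPre_mono φ.e (le_top : W ≤ ⊤)) s =
      φ.iso W (MvPowerSeries.C (SmoothFun.res le_top g)) := by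
    intro W
    rw [← φ.iso_res, ModelO.res, MvPowerSeries.map_C]
    rfl
  let W₀ : Opens (RN n) := ⟨(Metric.closedBall (φ.e a) (ε / 2))ᶜ,
    Metric.isClosed_closedBall.isOpen_compl⟩
  have hs₀ : M.resO (chartPre_mono φ.e (le_top : W₀ ≤ ⊤)) s = 0 := by
    rw [hs, show SmoothFun.res (le_top : W₀ ≤ ⊤) g = 0 from ?_, map_zero, map_zero]
    refine Subtype.ext (funext fun x => ?_)
    have hx : ε / 2 ≤ dist x.1 (φ.e a) := (not_le.1 (show ¬ dist x.1 (φ.e a) ≤ ε / 2 from x.2)).le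
    exact (congrArg _ (b.zero_of_le_dist hx)).trans Complex.ofReal_zero
  let W₁ : Opens (RN n) := ⟨Metric.ball (φ.e a) (ε / 4), Metric.isOpen_ball⟩
  have hs₁ : M.resO (chartPre_mono φ.e (le_top : W₁ ≤ ⊤)) s = 1 := by
    rw [hs, show SmoothFun.res (le_top : W₁ ≤ ⊤) g = 1 from ?_, map_one, map_one]
    refine Subtype.ext (funext fun x => ?_)
    exact (congrArg _ (b.one_of_mem_closedBall (Metric.ball_subset_closedBall x.2))).trans
      Complex.ofReal_one
  let V : Opens M.Pt := ⟨Cᶜ, hC.isClosed.isOpen_compl⟩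
  have hmem : ∀ x ∈ φ.e.source, x ∈ V → x ∈ chartPre φ.e W₀ := fun x hx hxV =>
    ⟨hx, fun h => hxV ⟨_, h, φ.e.left_inv hx⟩⟩
  -- The chart domain and the complement of `C` cover `M`; their intersection lies over `W₀`, where
  -- `s` vanishes.
  obtain ⟨f, hf₁, hf₂⟩ := exists_glueO (U₁ := chartPre φ.e ⊤) (U₂ := V)
    (le_top : _ ≤ (⊤ : Opens M.Pt)) le_top (fun x _ => by
      by_cases hx : x ∈ C
      · obtain ⟨y, -, rfl⟩ := hx
        exact Or.inl ⟨φ.symm_mem_source y, trivial⟩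
      · exact Or.inr hx) s (0 : M.O V) (by
      have h1 : chartPre φ.e ⊤ ⊓ V ≤ chartPre φ.e W₀ := fun x hx => hmem x hx.1.1 hx.2
      have h2 := congrArg (M.resO h1) hs₀
      rw [M.resO_resO, map_zero] at h2
      exact h2.trans (map_zero (M.resO inf_le_right)).symm)
  refine ⟨f, C, hC, hCU, fun V' hV' => ?_, chartPre φ.e W₁, ?_, ?_⟩
  · have h1 : V' ≤ V := fun x hx hxC => Set.disjoint_left.1 hV' hx hxC
    rw [← M.resO_resO le_top h1, hf₂, map_zero]
  · rintro _ rfl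
    exact ⟨hφ, Metric.mem_ball_self (by positivity)⟩
  · rw [← M.resO_resO le_top (chartPre_mono φ.e (le_top : W₁ ≤ ⊤)), hf₁, hs₁]

/-- Partitions of unity: finitely many formal functions with compact supports in the members of an
open cover, whose sum is `1` near a given compact set. -/
theorem exists_partition {Γ : Type w} {U : Γ → Opens M.Pt} {K : Set M.Pt} (hK : IsCompact K)
    (hKU : K ⊆ ⋃ γ, (U γ : Set M.Pt)) :
    ∃ (s : Finset Γ) (f : Γ → M.O ⊤) (C : Γ → Set M.Pt), (∀ γ, IsCompact (C γ)) ∧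
      (∀ γ, C γ ⊆ U γ) ∧ (∀ γ, VanishesOff (f γ) (C γ)) ∧ EqOneNear (∑ γ ∈ s, f γ) K := by
  classical
  -- The additional clause `f γ = 0` off `s` lets both sums in the union step be taken over `s ∪
  -- s'`.
  suffices ∃ (s : Finset Γ) (f : Γ → M.O ⊤) (C : Γ → Set M.Pt), (∀ γ, IsCompact (C γ)) ∧
      (∀ γ, C γ ⊆ U γ) ∧ (∀ γ, VanishesOff (f γ) (C γ)) ∧ (∀ γ ∉ s, f γ = 0) ∧
      EqOneNear (∑ γ ∈ s, f γ) K by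
    obtain ⟨s, f, C, h1, h2, h3, -, h4⟩ := this
    exact ⟨s, f, C, h1, h2, h3, h4⟩
  refine hK.induction_on (p := fun K => ∃ (s : Finset Γ) (f : Γ → M.O ⊤) (C : Γ → Set M.Pt),
      (∀ γ, IsCompact (C γ)) ∧ (∀ γ, C γ ⊆ U γ) ∧ (∀ γ, VanishesOff (f γ) (C γ)) ∧
      (∀ γ ∉ s, f γ = 0) ∧ EqOneNear (∑ γ ∈ s, f γ) K) ?_ ?_ ?_ ?_
  · refine ⟨∅, 0, fun _ => ∅, fun _ => isCompact_empty, fun _ => empty_subset _,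
      fun _ => VanishesOff.zero _, fun _ _ => rfl, ⊥, empty_subset _, ?_⟩
    exact M.X.sheaf.eq_of_locally_eq' (ι := Empty) (fun i => i.elim) ⊥ (fun i => i.elim) bot_le
      _ _ (fun i => i.elim)
  · rintro K K' hKK' ⟨s, f, C, h1, h2, h3, h4, h5⟩
    exact ⟨s, f, C, h1, h2, h3, h4, h5.mono hKK'⟩
  · rintro K K' ⟨s, f, C, h1, h2, h3, h4, W, hW, h5⟩ ⟨s', f', C', h1', h2', h3', h4', W', hW', h5'⟩
    have hs : ∑ γ ∈ s ∪ s', f γ = ∑ γ ∈ s, f γ :=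
      (Finset.sum_subset Finset.subset_union_left fun γ _ h => h4 γ h).symm
    have hs' : ∑ γ ∈ s ∪ s', f' γ = ∑ γ ∈ s', f' γ :=
      (Finset.sum_subset Finset.subset_union_right fun γ _ h => h4' γ h).symm
    -- With `σ` and `σ'` the two sums, the new sum `σ + (1 - σ) * σ'` differs from `1` by `(1 - σ) *
    -- (1 - σ')`, which vanishes wherever one of the sums is `1`.
    refine ⟨s ∪ s', fun γ => f γ + (1 - ∑ γ ∈ s, f γ) * f' γ, fun γ => C γ ∪ C' γ,
      fun γ => (h1 γ).union (h1' γ), fun γ => union_subset (h2 γ) (h2' γ),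
      fun γ => ((h3 γ).mono subset_union_left).add
        (((h3' γ).mono subset_union_right).mul_left _), fun γ hγ => ?_, W ⊔ W',
      union_subset_union hW hW', ?_⟩
    · rw [Finset.mem_union, not_or] at hγ
      beta_reduce
      rw [h4 γ hγ.1, h4' γ hγ.2, mul_zero, add_zero]
    · rw [Finset.sum_add_distrib, ← Finset.mul_sum, hs, hs',
        ← map_one (M.resO (le_top : W ⊔ W' ≤ ⊤))]
      refine resO_sup_eq ?_ ?_
      · simp only [map_add, map_mul, map_sub, map_one, h5]
        ring
      · simp only [map_add, map_mul, map_sub, map_one, h5']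
        ring
  · intro a ha
    obtain ⟨γ, hγ⟩ := mem_iUnion.1 (hKU ha)
    obtain ⟨f, C, hC, hCU, hf, W, hW, hfW⟩ := exists_bump (U := U γ) hγ
    refine ⟨W, mem_nhdsWithin_of_mem_nhds (W.isOpen.mem_nhds (hW rfl)), {γ}, Pi.single γ f,
      fun γ' => if γ' = γ then C else ∅, fun γ' => ?_, fun γ' => ?_, fun γ' => ?_,
      fun γ' h => ?_, W, subset_rfl, ?_⟩
    · beta_reduce
      split_ifs
      exacts [hC, isCompact_empty]
    · beta_reduce
      split_ifs with h
      · exact h ▸ hCU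
      · exact empty_subset _
    · beta_reduce
      split_ifs with h
      · subst h
        rwa [Pi.single_eq_same]
      · rw [Pi.single_eq_of_ne h]
        exact VanishesOff.zero _
    · exact Pi.single_eq_of_ne (fun h' => h (Finset.mem_singleton.2 h')) _
    · rwa [Finset.sum_singleton, Pi.single_eq_same]

/-- A cutoff function: it is `1` near `K` and has compact support in `U`. -/
theorem exists_cutoff {U : Opens M.Pt} {K : Set M.Pt} (hK : IsCompact K) (hKU : K ⊆ U) :
    ∃ (f : M.O ⊤) (C : Set M.Pt), IsCompact C ∧ C ⊆ U ∧ VanishesOff f C ∧ EqOneNear f K := by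
  obtain ⟨s, f, C, h1, h2, h3, h4⟩ := exists_partition (Γ := Unit) (U := fun _ => U) hK
    (hKU.trans (subset_iUnion (fun _ : Unit => (U : Set M.Pt)) ()))
  refine ⟨∑ γ ∈ s, f γ, C (), h1 _, h2 _, ?_, h4⟩
  exact Finset.sum_induction _ (VanishesOff · (C ())) (fun _ _ => VanishesOff.add)
    (VanishesOff.zero _) fun γ _ => h3 γ

end FormalManifold

end FormalMfd

namespace FormalMfd

namespace FormalManifold

variable {M : FormalManifold.{u}}

/-! ### Sections and components -/

namespace Sec

theorem res_res (P : M.PMod) {U V W : Opens M.Pt} (h : V ≤ U) (h' : W ≤ V) (s : Sec P U) :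
    res P h' (res P h s) = res P (h'.trans h) s :=
  (PresheafOfModules.congr_map_apply P
    (show (homOfLE (h'.trans h)).op = (homOfLE h).op ≫ (homOfLE h').op from rfl) s).trans
    (PresheafOfModules.map_comp_apply P _ _ s) |>.symm

theorem res_smul (P : M.PMod) {U V : Opens M.Pt} (h : V ≤ U) (f : M.O U) (s : Sec P U) :
    res P h (f • s) = M.resO h f • res P h s :=
  resAdd_smul P h f s

end Sec

theorem component_res {U : Opens M.Pt} {P Q : M.PMod} (D : SheafHom U P Q) {V W : Opens M.Pt}
    (h : V ≤ U) (h' : W ≤ V) (s : Sec P V) :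
    Sec.res Q h' (component D h s) = component D (h'.trans h) (Sec.res P h' s) :=
  D.2 ⟨V, h⟩ ⟨W, h'.trans h⟩ h' s

/-! ### Locality of operators with values in function modules, and their extension by zero. -/

namespace FunctionModule

variable {ι : Type u} (S : M.FunctionModule ι)

/-- The section of a function module with a given underlying family of functions. -/
def mkSec {U : Opens M.Pt} (g : ι → M.Pt → ℂ) (hg : g ∈ S.sec U) : Sec S.toPMod U :=
  (⟨g, hg⟩ : S.sec U)

theorem toFun_mkSec {U : Opens M.Pt} (g : ι → M.Pt → ℂ) (hg : g ∈ S.sec U) :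
    S.toFun (S.mkSec g hg) = g := rfl

theorem toFun_injective {U : Opens M.Pt} :
    Function.Injective (S.toFun : Sec S.toPMod U → ι → M.Pt → ℂ) :=
  Subtype.val_injective

theorem toFun_mem {U : Opens M.Pt} (s : Sec S.toPMod U) : S.toFun s ∈ S.sec U :=
  (show S.sec U from s).2

theorem toFun_of_notMem {U : Opens M.Pt} (s : Sec S.toPMod U) (i : ι) {a : M.Pt} (ha : a ∉ U) :
    S.toFun s i a = 0 :=
  S.supp (S.toFun_mem s) i a ha

theorem toFun_add {U : Opens M.Pt} (s t : Sec S.toPMod U) :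
    S.toFun (s + t) = S.toFun s + S.toFun t := rfl

theorem toFun_sub {U : Opens M.Pt} (s t : Sec S.toPMod U) :
    S.toFun (s - t) = S.toFun s - S.toFun t := rfl

theorem toFun_smul_apply {U : Opens M.Pt} (f : M.O U) (s : Sec S.toPMod U) (i : ι) (a : M.Pt) :
    S.toFun (f • s) i a = M.value f a * S.toFun s i a := rfl

theorem toFun_res {U V : Opens M.Pt} (h : V ≤ U) (s : Sec S.toPMod U) (i : ι) :
    S.toFun (Sec.res S.toPMod h s) i = (V : Set M.Pt).indicator (S.toFun s i) := rfl

theorem toFun_res_of_mem {U V : Opens M.Pt} (h : V ≤ U) (s : Sec S.toPMod U) (i : ι) {a : M.Pt}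
    (ha : a ∈ V) : S.toFun (Sec.res S.toPMod h s) i a = S.toFun s i a :=
  indicator_of_mem (s := (V : Set M.Pt)) ha _

/-- Compatibility with restriction makes `D` local: its value at `a` can be computed on any
neighborhood of `a`. -/
theorem toFun_component_congr {U : Opens M.Pt} {P : M.PMod} (D : SheafHom U P S.toPMod)
    {V W : Opens M.Pt} (h : V ≤ U) (h' : W ≤ V) {s t : Sec P V}
    (hst : Sec.res P h' s = Sec.res P h' t) (i : ι) {a : M.Pt} (ha : a ∈ W) :
    S.toFun (component D h s) i a = S.toFun (component D h t) i a := by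
  rw [← S.toFun_res_of_mem h' _ i ha, component_res, hst, ← component_res,
    S.toFun_res_of_mem h' _ i ha]

theorem toFun_component_eq_zero {U : Opens M.Pt} {P : M.PMod} {D : SheafHom U P S.toPMod}
    {K : Set M.Pt} (hK : IsClosed K) (hD : SuppIn D K) {V : Opens M.Pt} (h : V ≤ U) (s : Sec P V)
    (i : ι) {a : M.Pt} (ha : a ∉ K) : S.toFun (component D h s) i a = 0 := by
  by_cases haV : a ∈ V
  · let W : Opens M.Pt := V ⊓ ⟨Kᶜ, hK.isOpen_compl⟩
    have hW : W ≤ V := inf_le_left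
    have haW : a ∈ W := ⟨haV, ha⟩
    rw [← S.toFun_res_of_mem hW _ i haW, component_res,
      hD W (hW.trans h) (Set.disjoint_left.2 fun x hx => hx.2)]
    rfl
  · exact S.toFun_of_notMem _ i haV

/-- If `D` is supported in `K`, then `D s` only depends on `s` near `K`. -/
theorem component_congr_of_suppIn {U : Opens M.Pt} {P : M.PMod} {D : SheafHom U P S.toPMod}
    {K : Set M.Pt} (hK : IsClosed K) (hD : SuppIn D K) {V W : Opens M.Pt} (h : V ≤ U)
    (h' : W ≤ V) (hKW : (V : Set M.Pt) ∩ K ⊆ W) {s t : Sec P V}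
    (hst : Sec.res P h' s = Sec.res P h' t) : component D h s = component D h t := by
  refine S.toFun_injective (funext fun i => funext fun a => ?_)
  by_cases haV : a ∈ V
  · by_cases haK : a ∈ K
    · exact S.toFun_component_congr D h h' hst i (hKW ⟨haV, haK⟩)
    · rw [S.toFun_component_eq_zero hK hD h s i haK, S.toFun_component_eq_zero hK hD h t i haK]
  · rw [S.toFun_of_notMem _ i haV, S.toFun_of_notMem _ i haV]

/-- Sections that vanish outside of a closed subset of `U` can be extended by zero. -/
def ExtendsByZero : Prop :=
  ∀ (U V : Opens M.Pt) (K : Set M.Pt) (g : ι → M.Pt → ℂ), IsClosed K → K ⊆ U →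
    g ∈ S.sec (V ⊓ U) → (∀ i, ∀ a ∉ K, g i a = 0) → g ∈ S.sec V

/-- `D'` is the extension by zero of the homomorphism `D` over `U`. -/
def IsZeroExt {U : Opens M.Pt} {P : M.PMod} (D : SheafHom U P S.toPMod)
    (D' : SheafHom ⊤ P S.toPMod) : Prop :=
  ∀ (V W : Opens M.Pt) (hWV : W ≤ V) (hWU : W ≤ U), V ⊓ U ≤ W → ∀ s : Sec P V,
    S.toFun (component D' le_top s) = S.toFun (component D hWU (Sec.res P hWV s))

/-- The component over `V` of the extension by zero of `D`. -/
def zeroExtAt {U : Opens M.Pt} {P : M.PMod} (D : SheafHom U P S.toPMod) (V : Opens M.Pt)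
    (hV : ∀ s, S.toFun (component D inf_le_right (Sec.res P (inf_le_left : V ⊓ U ≤ V) s)) ∈
      S.sec V) : Sec P V →ₗ[ℂ] Sec S.toPMod V where
  toFun s := S.mkSec _ (hV s)
  map_add' s t := S.toFun_injective <| by simp only [toFun_add, toFun_mkSec, map_add]
  map_smul' c s := S.toFun_injective <| funext fun i => funext fun a => by
    rw [RingHom.id_apply, toFun_mkSec, map_smul, map_smul, Sec.smul_def, Sec.smul_def,
      toFun_smul_apply, toFun_smul_apply, toFun_mkSec]
    by_cases ha : a ∈ V ⊓ U
    · rw [M.value_cHom ha, M.value_cHom ha.1]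
    · rw [S.toFun_of_notMem _ i ha, mul_zero, mul_zero]

theorem toFun_zeroExtAt {U : Opens M.Pt} {P : M.PMod} (D : SheafHom U P S.toPMod)
    (V : Opens M.Pt) (hV) (s : Sec P V) : S.toFun (S.zeroExtAt D V hV s) =
      S.toFun (component D inf_le_right (Sec.res P (inf_le_left : V ⊓ U ≤ V) s)) := rfl

variable {S}

/-- Over `V`, one applies `D` on `V ⊓ U` and extends the resulting functions by zero. This gives
sections over `V` since these functions vanish outside of `K`, a closed subset of `M` inside `U`. -/
theorem ExtendsByZero.exists_isZeroExt (hS : S.ExtendsByZero) {U : Opens M.Pt} {P : M.PMod}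
    {D : SheafHom U P S.toPMod} {K : Set M.Pt} (hK : IsClosed K) (hKU : K ⊆ U) (hD : SuppIn D K) :
    ∃ D' : SheafHom ⊤ P S.toPMod, S.IsZeroExt D D' := by
  have hmem : ∀ (V : Opens M.Pt) (s : Sec P V),
      S.toFun (component D inf_le_right (Sec.res P (inf_le_left : V ⊓ U ≤ V) s)) ∈ S.sec V :=
    fun V s => hS U V K _ hK hKU (S.toFun_mem _) fun i a ha =>
      S.toFun_component_eq_zero hK hD _ _ i ha
  refine ⟨⟨fun V => S.zeroExtAt D V.1 (hmem V.1), fun V W h s => S.toFun_injective ?_⟩, ?_⟩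
  · refine funext fun i => funext fun a => ?_
    have h1 : W.1 ⊓ U ≤ V.1 ⊓ U := inf_le_inf_right U h
    rw [toFun_res, toFun_zeroExtAt, toFun_zeroExtAt, Sec.res_res,
      ← Sec.res_res P (inf_le_left : V.1 ⊓ U ≤ V.1) h1, ← component_res D inf_le_right h1,
      toFun_res]
    by_cases haU : a ∈ U
    · by_cases haW : a ∈ W.1
      · rw [indicator_of_mem (by exact haW), indicator_of_mem (by exact ⟨haW, haU⟩)]
      · rw [indicator_of_notMem (by exact haW), indicator_of_notMem fun h => haW h.1]
    · have h0 := S.toFun_of_notMem (component D inf_le_right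
        (Sec.res P (inf_le_left : V.1 ⊓ U ≤ V.1) s)) i (a := a) fun h => haU h.2
      simp only [Set.indicator, h0, ite_self]
  · intro V W hWV hWU hle s
    obtain rfl : V ⊓ U = W := le_antisymm hle (le_inf hWV hWU)
    exact S.toFun_zeroExtAt D V (hmem V) s

/-- The relation between `T'` and `T` passes to their commutators with `f` and with the restriction
of `f` to `W`, so the order bound transfers by induction on `r`. -/
theorem isDiffOp_of_toFun_eq {P : M.PMod} {V W : Opens M.Pt} (h : W ≤ V) {r : ℕ} :
    ∀ {T' : Sec P V →ₗ[ℂ] Sec S.toPMod V} {T : Sec P W →ₗ[ℂ] Sec S.toPMod W},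
    (∀ s, S.toFun (T' s) = S.toFun (T (Sec.res P h s))) → IsDiffOp (A := M.O W) r T →
    IsDiffOp (A := M.O V) r T' := by
  have key : ∀ {T' : Sec P V →ₗ[ℂ] Sec S.toPMod V} {T : Sec P W →ₗ[ℂ] Sec S.toPMod W},
      (∀ s, S.toFun (T' s) = S.toFun (T (Sec.res P h s))) → ∀ (f : M.O V) (s : Sec P V),
      S.toFun ((T' ∘ₗ Algebra.lsmul ℂ ℂ _ f - Algebra.lsmul ℂ ℂ _ f ∘ₗ T') s) =
      S.toFun ((T ∘ₗ Algebra.lsmul ℂ ℂ _ (M.resO h f) -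
        Algebra.lsmul ℂ ℂ _ (M.resO h f) ∘ₗ T) (Sec.res P h s)) := by
    intro T' T hT f s
    refine funext fun i => funext fun a => ?_
    simp only [LinearMap.sub_apply, LinearMap.comp_apply, Algebra.lsmul_coe, toFun_sub,
      Pi.sub_apply, toFun_smul_apply, hT, Sec.res_smul]
    by_cases ha : a ∈ W
    · rw [M.value_resO h f ha]
    · rw [S.toFun_of_notMem (T (Sec.res P h s)) i ha, mul_zero, mul_zero]
  induction r with
  | zero =>
    intro T' T hT hr f
    refine LinearMap.ext fun s => S.toFun_injective ?_
    rw [key hT, hr]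
    rfl
  | succ r ih =>
    intro T' T hT hr f
    exact ih (key hT f) (hr (M.resO h f))

variable {U : Opens M.Pt} {P : M.PMod} {D : SheafHom U P S.toPMod} {D' : SheafHom ⊤ P S.toPMod}

theorem IsZeroExt.hasOrder (h : S.IsZeroExt D D') {V : Opens M.Pt} (hV : V ≤ U) {r : ℕ}
    (hr : HasOrder D hV r) : HasOrder D' (le_top : V ≤ ⊤) r := fun W hW =>
  isDiffOp_of_toFun_eq le_rfl (h W W le_rfl (hW.trans hV) inf_le_left) (hr W hW)

theorem IsZeroExt.hasOrder_top (h : S.IsZeroExt D D') {r : ℕ}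
    (hr : HasOrder D le_rfl r) : HasOrder D' le_rfl r := fun V _ =>
  isDiffOp_of_toFun_eq inf_le_left (h V (V ⊓ U) inf_le_left inf_le_right le_rfl)
    (hr (V ⊓ U) inf_le_right)

theorem IsZeroExt.suppIn (h : S.IsZeroExt D D') {K : Set M.Pt} (hD : SuppIn D K) :
    SuppIn D' K := fun V _ hVK => LinearMap.ext fun s => S.toFun_injective <| by
  rw [h V (V ⊓ U) inf_le_left inf_le_right le_rfl s,
    hD (V ⊓ U) inf_le_right (hVK.mono_left inter_subset_left)]
  rfl

theorem IsZeroExt.mem_DiffC (h : S.IsZeroExt D D') (hD : D ∈ DiffC U P S.toPMod) :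
    D' ∈ DiffC ⊤ P S.toPMod := by
  obtain ⟨hr, K, hK, hKU, hDK⟩ := hD
  refine ⟨fun a _ => ?_, K, hK, fun _ _ => trivial, h.suppIn hDK⟩
  by_cases ha : a ∈ K
  · obtain ⟨V, hV, r, haV, hVr⟩ := hr a (hKU ha)
    exact ⟨V, le_top, r, haV, h.hasOrder hV hVr⟩
  -- Away from `K` the extension is zero, so it has order `0` there.
  · refine ⟨⟨Kᶜ, hK.isClosed.isOpen_compl⟩, le_top, 0, ha, fun W hW => ?_⟩
    rw [h.suppIn hDK W le_top (Set.disjoint_left.2 fun x hx => hW hx)]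
    exact IsDiffOp.zero 0

end FunctionModule

/-- The condition is local: at points of `U` it is known, and every other point has the complement
of `K` as a neighborhood, where `g` is zero. -/
theorem extendsByZero_redFunctions : M.redFunctions.ExtendsByZero := by
  rintro U V K g hK hKU ⟨h1, h2⟩ hg
  refine ⟨fun i a ha => h1 i a fun h => ha h.1, fun i a ha => ?_⟩
  by_cases haU : a ∈ U
  · obtain ⟨W, f, haW, hW, hf⟩ := h2 i a ⟨ha, haU⟩
    exact ⟨W, f, haW, hW.trans inf_le_left, hf⟩
  · refine ⟨V ⊓ ⟨Kᶜ, hK.isOpen_compl⟩, 0, ⟨ha, fun h => haU (hKU h)⟩, inf_le_left, fun b hb => ?_⟩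
    rw [hg i b hb.2, M.value_zero]

theorem extendsByZero_redDensities : M.redDensities.ExtendsByZero := by
  intro U V K g hK hKU h hg
  have h : IsDensity (V ⊓ U) g := h
  refine ⟨fun φ a ha => h.supp φ a fun h => ha h.1, h.supp_chart, fun φ x hx => ?_,
    fun n φ ψ a ha hφ hψ => ?_⟩
  · have hs := φ.2.continuous_symm
    by_cases hxU : φ.2.e.symm x ∈ U
    · exact ((h.smooth φ).contDiffAt
        (((V ⊓ U).isOpen.preimage hs).mem_nhds ⟨hx, hxU⟩)).contDiffWithinAt
    · have hev : (fun x => g φ (φ.2.e.symm x)) =ᶠ[𝓝 x] fun _ => 0 := by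
        filter_upwards [(hK.isOpen_compl.preimage hs).mem_nhds fun h => hxU (hKU h)] with y hy
        exact hg _ _ hy
      exact (contDiffAt_const.congr_of_eventuallyEq hev).contDiffWithinAt
  · by_cases haU : a ∈ U
    · exact h.transf n φ ψ a ⟨ha, haU⟩ hφ hψ
    · rw [hg _ a fun h => haU (hKU h), hg _ a fun h => haU (hKU h), mul_zero]

/-! ### Multiplication by a cutoff function -/

/-- Multiplications commute with each other, so `[T ∘ g, f] = [T, f] ∘ g` and the order does not
increase. -/
theorem IsDiffOp.comp_lsmul {A : Type*} [CommRing A] [Algebra ℂ A] {N₁ N₂ : Type*}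
    [AddCommGroup N₁] [Module ℂ N₁] [Module A N₁] [IsScalarTower ℂ A N₁]
    [AddCommGroup N₂] [Module ℂ N₂] [Module A N₂] [IsScalarTower ℂ A N₂] (g : A) {r : ℕ} :
    ∀ {T : N₁ →ₗ[ℂ] N₂}, IsDiffOp (A := A) r T →
      IsDiffOp (A := A) r (T ∘ₗ Algebra.lsmul ℂ ℂ N₁ g) := by
  have key : ∀ (T : N₁ →ₗ[ℂ] N₂) (f : A),
      (T ∘ₗ Algebra.lsmul ℂ ℂ N₁ g) ∘ₗ Algebra.lsmul ℂ ℂ N₁ f -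
        Algebra.lsmul ℂ ℂ N₂ f ∘ₗ (T ∘ₗ Algebra.lsmul ℂ ℂ N₁ g) =
      (T ∘ₗ Algebra.lsmul ℂ ℂ N₁ f - Algebra.lsmul ℂ ℂ N₂ f ∘ₗ T) ∘ₗ
        Algebra.lsmul ℂ ℂ N₁ g := by
    intro T f
    ext s
    simp [smul_comm f g s]
  induction r with
  | zero =>
    intro T h f
    rw [key, h f, LinearMap.zero_comp]
  | succ r ih =>
    intro T h f
    rw [key]
    exact ih (h f)

variable {U U' : Opens M.Pt} {P Q : M.PMod}

/-- The restriction to `U` of `D ∘ f`, where `f` is a global formal function. -/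
def cutoff (h : U ≤ U') (f : M.O ⊤) (D : SheafHom U' P Q) : SheafHom U P Q :=
  ⟨fun V => component D (V.2.trans h) ∘ₗ Algebra.lsmul ℂ ℂ _ (M.resO le_top f), fun V W hWV s => by
    simp only [LinearMap.comp_apply, Algebra.lsmul_coe]
    rw [component_res, Sec.res_smul, M.resO_resO]⟩

theorem component_cutoff (h : U ≤ U') (f : M.O ⊤) (D : SheafHom U' P Q) {V : Opens M.Pt}
    (hV : V ≤ U) (s : Sec P V) :
    component (cutoff h f D) hV s = component D (hV.trans h) (M.resO (le_top : V ≤ ⊤) f • s) := rfl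

theorem hasOrder_cutoff (h : U ≤ U') (f : M.O ⊤) {D : SheafHom U' P Q} {V : Opens M.Pt}
    (hV : V ≤ U) {r : ℕ} {W : Opens M.Pt} (hW : W ≤ U') (hr : HasOrder D hW r) (hVW : V ≤ W) :
    HasOrder (cutoff h f D) hV r := fun W' hW' =>
  (hr W' (hW'.trans hVW)).comp_lsmul _

theorem suppIn_cutoff (h : U ≤ U') {f : M.O ⊤} {C : Set M.Pt} (hf : VanishesOff f C)
    (D : SheafHom U' P Q) : SuppIn (cutoff h f D) C := fun V hV hVC => LinearMap.ext fun s => by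
  rw [component_cutoff, hf V hVC, zero_smul, map_zero, LinearMap.zero_apply]

theorem cutoff_mem_DiffC (h : U ≤ U') {f : M.O ⊤} {C : Set M.Pt} (hC : IsCompact C)
    (hCU : C ⊆ U) (hf : VanishesOff f C) {D : SheafHom U' P Q} (hD : D ∈ DiffC U' P Q) :
    cutoff h f D ∈ DiffC U P Q := by
  refine ⟨fun a ha => ?_, C, hC, hCU, suppIn_cutoff h hf D⟩
  obtain ⟨V, hV, r, haV, hr⟩ := hD.1 a (h ha)
  exact ⟨V ⊓ U, inf_le_right, r, ⟨haV, ha⟩, hasOrder_cutoff h f _ hV hr inf_le_left⟩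

/-! ### Extension by zero of sections -/

theorem exists_glueSec (F : M.Mod) {U₁ U₂ V : Opens M.Pt} (h₁ : U₁ ≤ V) (h₂ : U₂ ≤ V)
    (hV : V ≤ U₁ ⊔ U₂) (s₁ : Sec F.val U₁) (s₂ : Sec F.val U₂)
    (h : Sec.res F.val (inf_le_left : U₁ ⊓ U₂ ≤ U₁) s₁ =
      Sec.res F.val (inf_le_right : U₁ ⊓ U₂ ≤ U₂) s₂) :
    ∃ s : Sec F.val V, Sec.res F.val h₁ s = s₁ ∧ Sec.res F.val h₂ s = s₂ :=
  let F' : TopCat.Sheaf AddCommGrpCat.{u} M.X.toTopCat := ⟨F.val.presheaf, F.isSheaf⟩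
  let t₁ : ToType (F'.1.obj (op U₁)) := s₁
  let t₂ : ToType (F'.1.obj (op U₂)) := s₂
  exists_glue₂ F' h₁ h₂ hV t₁ t₂ h

theorem eq_of_res_eq (F : M.Mod) {U₁ U₂ V : Opens M.Pt} (h₁ : U₁ ≤ V) (h₂ : U₂ ≤ V)
    (hV : V ≤ U₁ ⊔ U₂) {s t : Sec F.val V} (hs₁ : Sec.res F.val h₁ s = Sec.res F.val h₁ t)
    (hs₂ : Sec.res F.val h₂ s = Sec.res F.val h₂ t) : s = t :=
  TopCat.Sheaf.eq_of_locally_eq₂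
    (⟨F.val.presheaf, F.isSheaf⟩ : TopCat.Sheaf AddCommGrpCat.{u} M.X.toTopCat)
    (homOfLE h₁) (homOfLE h₂) hV s t hs₁ hs₂

/-- The map `F(U) → F(M)` which sends `u` to the extension by zero of `f u`, where `f` vanishes
outside of a closed subset of `U`. -/
theorem exists_extendSec (F : M.Mod) {f : M.O ⊤} {C : Set M.Pt} (hC : IsClosed C) (hCU : C ⊆ U)
    (hf : VanishesOff f C) : ∃ ε : Sec F.val U →ₗ[ℂ] Sec F.val (⊤ : Opens M.Pt), ∀ u,
      Sec.res F.val le_top (ε u) = M.resO (le_top : U ≤ ⊤) f • u ∧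
      ∀ V : Opens M.Pt, Disjoint (V : Set M.Pt) C → Sec.res F.val (le_top : V ≤ ⊤) (ε u) = 0 := by
  let V₀ : Opens M.Pt := ⟨Cᶜ, hC.isOpen_compl⟩
  have hV₀ : (⊤ : Opens M.Pt) ≤ U ⊔ V₀ := fun x _ => by
    by_cases hx : x ∈ C
    exacts [Or.inl (hCU hx), Or.inr hx]
  have hex : ∀ u : Sec F.val U, ∃ s : Sec F.val (⊤ : Opens M.Pt),
      Sec.res F.val le_top s = M.resO (le_top : U ≤ ⊤) f • u ∧
      Sec.res F.val (le_top : V₀ ≤ ⊤) s = 0 := fun u =>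
    exists_glueSec F le_top le_top hV₀ _ _ <| by
      rw [Sec.res_smul, M.resO_resO, hf (U ⊓ V₀) (Set.disjoint_left.2 fun x hx => hx.2),
        zero_smul, map_zero]
  choose ε hε using hex
  -- Linearity of the chosen `ε` follows from the uniqueness of gluing over `U` and the complement
  -- of `C`.
  refine ⟨⟨⟨ε, fun u u' => ?_⟩, fun c u => ?_⟩, fun u => ⟨(hε u).1, fun V hV => ?_⟩⟩
  · refine eq_of_res_eq F le_top le_top hV₀ ?_ ?_
    · rw [map_add, (hε _).1, (hε _).1, (hε _).1, smul_add]
    · rw [map_add, (hε _).2, (hε _).2, (hε _).2, add_zero]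
  · refine eq_of_res_eq F le_top le_top hV₀ ?_ ?_
    · change Sec.res F.val le_top (ε (c • u)) = Sec.res F.val le_top (c • ε u)
      rw [map_smul, (hε (c • u)).1, (hε u).1]
      exact smul_comm _ c u
    · change Sec.res F.val le_top (ε (c • u)) = Sec.res F.val le_top (c • ε u)
      rw [map_smul, (hε (c • u)).2, (hε u).2, smul_zero]
  · have h1 : V ≤ V₀ := fun x hx hxC => Set.disjoint_left.1 hV hx hxC
    have h2 := congrArg (Sec.res F.val h1) (hε u).2
    rwa [Sec.res_res, map_zero] at h2

end FormalManifold

end FormalMfd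

namespace FormalMfd

namespace FormalManifold

variable {M : FormalManifold.{u}}

/-! ### Continuity criteria -/

theorem continuous_inclusion_Dc (F : M.Mod) {U : Opens M.Pt} (p : CIndex U) :
    Continuous (Submodule.inclusion (DKr_le_Dc F p)) :=
  continuous_sInf_rng.2 fun _ h => h.2.2.2 p

/-- The universal property of the locally convex inductive limit: the topology pulled back from `E`
along `L` is one of the topologies whose infimum defines that of `Dc F U`. -/
theorem continuous_of_continuous_DKr {F : M.Mod} {U : Opens M.Pt} {E : Type*} [AddCommGroup E]
    [Module ℂ E] [TopologicalSpace E] [IsTopologicalAddGroup E] [ContinuousSMul ℂ E]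
    [LocallyConvexSpace ℝ E] (L : Dc F U →ₗ[ℂ] E)
    (h : ∀ p : CIndex U, Continuous fun η : DKr F p => L (Submodule.inclusion (DKr_le_Dc F p) η)) :
    Continuous L :=
  continuous_iff_le_induced.2 <| sInf_le ⟨topologicalAddGroup_induced L, continuousSMul_induced L,
    LocallyConvexSpace.induced (L.restrictScalars ℝ), fun p => continuous_induced_rng.2 (h p)⟩

/-- The topology on operators is initial for the maps `D ↦ (X ∘ D) u`, so it suffices that each such
map, composed with `T`, is again a map of this kind. -/
theorem continuous_DiffKr {F : M.Mod} {U V : Opens M.Pt} {p : CIndex U} {q : CIndex V}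
    (T : DiffKr F.val M.dens p → DiffKr F.val M.dens q)
    (h : ∀ (X : DiffC V M.dens M.redO) (u : Sec F.val V),
      ∃ (X' : DiffC U M.dens M.redO) (u' : Sec F.val U), ∀ D : DiffKr F.val M.dens p,
        M.redFunctions.toFun (component X.1 le_rfl (component (T D).1 le_rfl u)) =
          M.redFunctions.toFun (component X'.1 le_rfl (component D.1 le_rfl u'))) :
    Continuous T := by
  refine continuous_induced_rng.2 (continuous_iInf_rng.2 fun X => continuous_iInf_rng.2 fun u =>
    continuous_induced_rng.2 ?_)
  obtain ⟨X', u', hX⟩ := h X u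
  have h1 : Continuous fun D : DiffFin U F.val M.dens => UniformFun.ofFun
      (M.redFunctions.toFun (component X'.1 le_rfl (component D.1 le_rfl u')) PUnit.unit) :=
    continuous_iInf_dom (i := X') (continuous_iInf_dom (i := u') continuous_induced_dom)
  have h2 : Continuous (Submodule.inclusion (DiffKr_le_DiffFin F.val M.dens p)) :=
    continuous_induced_dom
  exact (h1.comp h2).congr fun D => congrArg UniformFun.ofFun (congrFun (hX D).symm _)

/-- A linear map `F(U) → F(V)` whose transpose preserves formal densities induces a linear map
`D^∞_c(V; F) → D^∞_c(U; F)`. -/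
def transposeDc {F : M.Mod} {U V : Opens M.Pt} (ε : Sec F.val U →ₗ[ℂ] Sec F.val V)
    (h : ∀ η ∈ Dc F V, η ∘ₗ ε ∈ Dc F U) : Dc F V →ₗ[ℂ] Dc F U :=
  (LinearMap.lcomp ℂ ℂ ε).restrict h

/-- As `DKr` carries the quotient topology, continuity may be checked on operators. The lift `T` can
be any continuous function; no linearity is needed. -/
theorem continuous_transposeDc {F : M.Mod} {U V : Opens M.Pt}
    (ε : Sec F.val U →ₗ[ℂ] Sec F.val V) (h : ∀ η ∈ Dc F V, η ∘ₗ ε ∈ Dc F U)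
    (hε : ∀ p : CIndex V, ∃ (q : CIndex U) (T : DiffKr F.val M.dens p → DiffKr F.val M.dens q),
      Continuous T ∧ ∀ D u, rhoKr F p D (ε u) = rhoKr F q (T D) u) :
    Continuous (transposeDc ε h) := by
  refine continuous_of_continuous_DKr _ fun p => continuous_coinduced_dom.2 ?_
  obtain ⟨q, T, hT, hρ⟩ := hε p
  have h1 : Continuous (Y := DKr F q) (rhoKr F q).rangeRestrict := continuous_coinduced_rng
  exact ((continuous_inclusion_Dc F q).comp (h1.comp hT)).congr fun D =>
    Subtype.ext (LinearMap.ext fun u => (hρ D u).symm)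

/-! ### The extension maps -/

variable (F : M.Mod) {U : Opens M.Pt}

theorem rho_apply {P : M.PMod} (D : DiffC U P M.dens) (u : Sec P U) :
    rho U P D u = integral (M.redDensities.toFun (component D.1 le_rfl u)) := rfl

theorem exists_zeroExt_dens {P : M.PMod} {D : SheafHom U P M.dens} {K : Set M.Pt}
    (hK : IsCompact K) (hKU : K ⊆ U) (hD : SuppIn D K) :
    ∃ D' : SheafHom ⊤ P M.dens, M.redDensities.IsZeroExt D D' :=
  extendsByZero_redDensities.exists_isZeroExt hK.isClosed hKU hD

theorem comp_res_mem_Dc (η : Sec F.val U →ₗ[ℂ] ℂ) (hη : η ∈ Dc F U) :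
    η ∘ₗ Sec.res F.val (le_top : U ≤ ⊤) ∈ Dc F ⊤ := by
  obtain ⟨⟨D, hr, K, hK, hKU, hD⟩, rfl⟩ := hη
  obtain ⟨D', hD'⟩ := exists_zeroExt_dens hK hKU hD
  refine ⟨⟨D', hD'.mem_DiffC ⟨hr, K, hK, hKU, hD⟩⟩, LinearMap.ext fun u => ?_⟩
  exact congrArg integral (hD' ⊤ U le_top le_rfl inf_le_right u)

/-- This bounds the seminorms of the zero extension `D'` by those of `D`. The support of `X` need
not lie in `U`, so `X` is replaced by `X ∘ f`, which can be cut down to `U`; this changes nothing,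
as the values of `D` are supported in `K`, where `f` is `1`. -/
theorem toFun_component_zeroExt {D : SheafHom U F.val M.dens} {D' : SheafHom ⊤ F.val M.dens}
    (hDD' : M.redDensities.IsZeroExt D D') {K : Set M.Pt} (hK : IsClosed K) (hKU : K ⊆ U)
    (hD : SuppIn D K) {f : M.O ⊤} (hfK : EqOneNear f K)
    (X : SheafHom ⊤ M.dens M.redO) (u : Sec F.val ⊤) :
    M.redFunctions.toFun (component X le_rfl (component D' le_rfl u)) =
      M.redFunctions.toFun (component (cutoff le_top f X : SheafHom U M.dens M.redO) le_rfl
        (component D le_rfl (Sec.res F.val le_top u))) := by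
  set τ := component D' le_rfl u
  set σ := component D le_rfl (Sec.res F.val (le_top : U ≤ ⊤) u)
  have hτσ : M.redDensities.toFun τ = M.redDensities.toFun σ :=
    hDD' ⊤ U le_top le_rfl inf_le_right u
  have hσ : ∀ φ, ∀ a ∉ K, M.redDensities.toFun σ φ a = 0 := fun φ a ha =>
    M.redDensities.toFun_component_eq_zero hK hD _ _ φ ha
  have hres : Sec.res M.dens (le_top : U ≤ ⊤) τ = M.resO (le_top : U ≤ ⊤) f • σ := by
    refine M.redDensities.toFun_injective (funext fun φ => funext fun a => ?_)
    rw [M.redDensities.toFun_res, M.redDensities.toFun_smul_apply, hτσ]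
    by_cases haU : a ∈ U
    · rw [indicator_of_mem (by exact haU), M.value_resO _ _ haU]
      by_cases haK : a ∈ K
      · obtain ⟨W, hW, hfW⟩ := hfK
        rw [← M.value_resO (le_top : W ≤ ⊤) f (hW haK), hfW, M.value_one (hW haK), one_mul]
      · rw [hσ φ a haK, mul_zero]
    · rw [indicator_of_notMem (by exact haU), M.redDensities.toFun_of_notMem σ φ haU, mul_zero]
  refine funext fun i => funext fun a => ?_
  by_cases haU : a ∈ U
  -- On `U` the claim is locality of `X` together with `hres`. Off `U` the right side is zero by
  -- convention, and the left side is zero since `τ` vanishes off `K`.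
  · rw [component_cutoff, ← hres, ← component_res X le_rfl le_top,
      M.redFunctions.toFun_res_of_mem _ _ i haU]
  · let W : Opens M.Pt := ⟨Kᶜ, hK.isOpen_compl⟩
    have hτ : Sec.res M.dens (le_top : W ≤ ⊤) τ = Sec.res M.dens le_top 0 := by
      refine M.redDensities.toFun_injective (funext fun φ => ?_)
      rw [M.redDensities.toFun_res, M.redDensities.toFun_res, hτσ]
      exact indicator_congr fun b hb => hσ φ b hb
    rw [M.redFunctions.toFun_of_notMem _ i haU, M.redFunctions.toFun_component_congr X le_rfl
      le_top hτ i (show a ∈ W from fun h => haU (hKU h)), map_zero]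
    rfl

/-- The extension map `ext_{M,U}`. -/
def extDc (U : Opens M.Pt) : Dc F U →L[ℂ] Dc F ⊤ where
  toLinearMap := transposeDc (Sec.res F.val le_top) (comp_res_mem_Dc F)
  cont := by
    refine continuous_transposeDc _ _ fun p => ?_
    obtain ⟨f, C, hC, hCU, hf, hfK⟩ := exists_cutoff p.2.1 p.2.2
    have hex : ∀ D : DiffKr F.val M.dens p, ∃ D' : SheafHom ⊤ F.val M.dens,
        M.redDensities.IsZeroExt D.1 D' := fun D => exists_zeroExt_dens p.2.1 p.2.2 D.2.2
    choose T hT using hex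
    refine ⟨⟨p.1, p.2.1, fun _ _ => trivial⟩,
      fun D => ⟨T D, (hT D).hasOrder_top D.2.1, (hT D).suppIn D.2.2⟩,
      continuous_DiffKr _ fun X u => ⟨⟨cutoff le_top f X.1, cutoff_mem_DiffC le_top hC hCU hf X.2⟩,
        Sec.res F.val le_top u, fun D => ?_⟩, fun D u => ?_⟩
    · exact toFun_component_zeroExt F (hT D) p.2.1.isClosed p.2.2 D.2.2 hfK X.1 u
    · exact (congrArg integral (hT D ⊤ U le_top le_rfl inf_le_right u)).symm

theorem extDc_apply (η : Dc F U) (u : Sec F.val ⊤) :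
    (extDc F U η).1 u = η.1 (Sec.res F.val le_top u) := rfl

/-! ### Localization of formal densities -/

variable {F}

/-- `ε u` is the extension by zero of `f u`, where `f` vanishes outside of `C`. -/
def IsExtendSec (f : M.O ⊤) (C : Set M.Pt) (ε : Sec F.val U →ₗ[ℂ] Sec F.val (⊤ : Opens M.Pt)) :
    Prop :=
  ∀ u, Sec.res F.val le_top (ε u) = M.resO (le_top : U ≤ ⊤) f • u ∧
    ∀ V : Opens M.Pt, Disjoint (V : Set M.Pt) C → Sec.res F.val (le_top : V ≤ ⊤) (ε u) = 0

variable {f : M.O ⊤} {C : Set M.Pt} {ε : Sec F.val U →ₗ[ℂ] Sec F.val (⊤ : Opens M.Pt)}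

/-- On `U` this holds because `ε u` restricts to `f u`; outside of `U` both sides vanish, since `ε
u` is zero off `C`. -/
theorem IsExtendSec.toFun_component (hε : IsExtendSec f C ε) (hC : IsClosed C) (hCU : C ⊆ U)
    (D : SheafHom ⊤ F.val M.dens) (u : Sec F.val U) :
    M.redDensities.toFun (component D le_rfl (ε u)) =
      M.redDensities.toFun (component (cutoff le_top f D : SheafHom U F.val M.dens) le_rfl u) := by
  refine funext fun φ => funext fun a => ?_
  by_cases haU : a ∈ U
  · rw [component_cutoff, ← (hε u).1, ← component_res D le_rfl le_top,
      M.redDensities.toFun_res_of_mem _ _ φ haU]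
  · let W : Opens M.Pt := ⟨Cᶜ, hC.isOpen_compl⟩
    rw [M.redDensities.toFun_of_notMem _ φ haU, M.redDensities.toFun_component_congr D le_rfl
      (le_top : W ≤ ⊤) (t := 0) ?_ φ (show a ∈ W from fun h => haU (hCU h)), map_zero]
    · rfl
    · rw [map_zero, (hε u).2 W disjoint_compl_left]

theorem IsExtendSec.comp_mem_Dc (hε : IsExtendSec f C ε) (hC : IsCompact C) (hCU : C ⊆ U)
    (hf : VanishesOff f C) (η : Sec F.val ⊤ →ₗ[ℂ] ℂ) (hη : η ∈ Dc F ⊤) : η ∘ₗ ε ∈ Dc F U := by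
  obtain ⟨D, rfl⟩ := hη
  exact ⟨⟨cutoff le_top f D.1, cutoff_mem_DiffC le_top hC hCU hf D.2⟩, LinearMap.ext fun u =>
    (congrArg integral (hε.toFun_component hC.isClosed hCU D.1 u)).symm⟩

/-- The map `m` is the transpose of the map `ε` that multiplies by `f` and extends by zero. On
operators it is `D ↦ (D ∘ f)|_U`. -/
theorem exists_localize (F : M.Mod) {U : Opens M.Pt} {f : M.O ⊤} {C : Set M.Pt}
    (hC : IsCompact C) (hCU : C ⊆ U) (hf : VanishesOff f C) :
    ∃ m : Dc F ⊤ →L[ℂ] Dc F U, ∀ η u, (extDc F U (m η)).1 u = η.1 (f • u) := by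
  obtain ⟨ε, hε⟩ := exists_extendSec F hC.isClosed hCU hf
  have hε : IsExtendSec f C ε := hε
  refine ⟨⟨transposeDc ε (hε.comp_mem_Dc hC hCU hf), continuous_transposeDc _ _ fun p => ?_⟩,
    fun η u => congrArg η.1 ?_⟩
  -- The support becomes `C`, whatever the support of `D` was, and the order bound is kept.
  · refine ⟨⟨⟨C, p.1.2⟩, hC, hCU⟩, fun D => ⟨cutoff le_top f D.1,
      hasOrder_cutoff le_top f le_rfl le_rfl D.2.1 le_top, suppIn_cutoff le_top hf D.1⟩,
      continuous_DiffKr _ fun X u => ?_, fun D u => ?_⟩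
    -- A test operator `X` over `U` extends by zero to `X'` over `M`, and `X (D (f u)) = X' (D (ε
    -- u))`.
    · obtain ⟨hr, K, hK, hKU, hXK⟩ := X.2
      obtain ⟨X', hX'⟩ := extendsByZero_redFunctions.exists_isZeroExt hK.isClosed hKU hXK
      refine ⟨⟨X', hX'.mem_DiffC X.2⟩, ε u, fun D => ?_⟩
      rw [hX' ⊤ U le_top le_rfl inf_le_right, component_res, (hε u).1]
      rfl
    · exact congrArg integral (hε.toFun_component hC.isClosed hCU D.1 u)
  -- It remains to see that `ε (u|_U) = f u`; both sides agree on `U` and vanish off `C`.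
  · let V₀ : Opens M.Pt := ⟨Cᶜ, hC.isClosed.isOpen_compl⟩
    have hV₀ : Disjoint (V₀ : Set M.Pt) C := disjoint_compl_left
    refine eq_of_res_eq F (U₁ := U) (U₂ := V₀) le_top le_top (fun x _ => ?_) ?_ ?_
    · by_cases hx : x ∈ C
      exacts [Or.inl (hCU hx), Or.inr hx]
    · rw [(hε _).1, Sec.res_smul]
    · rw [(hε _).2 V₀ hV₀, Sec.res_smul, hf V₀ hV₀, zero_smul]

/-- A formal density that comes from a differential operator supported in `K` only depends on
sections near `K`. -/
theorem rho_smul_of_eqOneNear {D : DiffC ⊤ F.val M.dens} {K : Set M.Pt} (hK : IsClosed K)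
    (hD : SuppIn D.1 K) (hf : EqOneNear f K) (u : Sec F.val ⊤) :
    rho ⊤ F.val D (f • u) = rho ⊤ F.val D u := by
  obtain ⟨W, hW, hfW⟩ := hf
  rw [rho_apply, rho_apply, M.redDensities.component_congr_of_suppIn hK hD le_rfl
    (le_top : W ≤ ⊤) (inter_subset_right.trans hW) (t := u)]
  rw [Sec.res_smul, hfW, one_smul]

/-- Decomposition of the formal densities that come from differential operators supported in `K`
with respect to an open cover. -/
theorem exists_decomposition (F : M.Mod) {Γ : Type w} {U : Γ → Opens M.Pt} (hU : ⨆ γ, U γ = ⊤)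
    {K : Set M.Pt} (hK : IsCompact K) :
    ∃ (s : Finset Γ) (m : ∀ γ, Dc F ⊤ →L[ℂ] Dc F (U γ)), ∀ (D : DiffC ⊤ F.val M.dens) (η : Dc F ⊤),
      SuppIn D.1 K → η.1 = rho ⊤ F.val D → ∑ γ ∈ s, extDc F (U γ) (m γ η) = η := by
  obtain ⟨s, f, C, hC, hCU, hf, hfK⟩ := exists_partition (U := U) hK fun x _ => by
    have : x ∈ ⨆ γ, U γ := hU ▸ trivial
    obtain ⟨γ, hγ⟩ := Opens.mem_iSup.1 this
    exact mem_iUnion.2 ⟨γ, hγ⟩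
  choose m hm using fun γ => exists_localize F (hC γ) (hCU γ) (hf γ)
  refine ⟨s, m, fun D η hD hη => Subtype.ext (LinearMap.ext fun u => ?_)⟩
  -- Since `∑ f γ` is `1` near `K`, replacing `u` by `(∑ f γ) • u` does not change `η u`.
  rw [AddSubmonoidClass.coe_finsetSum, LinearMap.sum_apply, hη,
    ← rho_smul_of_eqOneNear hK.isClosed hD hfK, ← hη, Finset.sum_smul, map_sum]
  exact Finset.sum_congr rfl fun γ _ => hm γ η u

end FormalManifold

end FormalMfd

namespace FormalMfd

/-! ### Restriction of continuous linear maps to a family of spaces -/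

section RestrictCLM

/-- Compose `L` with a linear section `g` of `A`: the difference of `g (A x)` and `x` lies in the
kernel of `A`. -/
theorem exists_comp_eq_of_ker_le {X Y Z : Type*} [AddCommGroup X] [AddCommGroup Y]
    [AddCommGroup Z] [Module ℂ X] [Module ℂ Y] [Module ℂ Z] {A : X →ₗ[ℂ] Y}
    (hA : Function.Surjective A) (L : X →ₗ[ℂ] Z) (h : ∀ x, A x = 0 → L x = 0) :
    ∃ u : Y →ₗ[ℂ] Z, ∀ x, u (A x) = L x := by
  obtain ⟨g, hg⟩ := A.exists_rightInverse_of_surjective (LinearMap.range_eq_top.2 hA)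
  refine ⟨L ∘ₗ g, fun x => ?_⟩
  rw [LinearMap.comp_apply, ← sub_eq_zero, ← map_sub]
  refine h _ ?_
  rw [map_sub, sub_eq_zero]
  exact LinearMap.congr_fun hg (A x)

variable {Γ : Type*} {X : Type*} [AddCommGroup X] [Module ℂ X] [TopologicalSpace X]
  {Y : Γ → Type*} [∀ γ, AddCommGroup (Y γ)] [∀ γ, Module ℂ (Y γ)] [∀ γ, TopologicalSpace (Y γ)]
  (e : ∀ γ, Y γ →L[ℂ] X) (E : Type*) [AddCommGroup E] [Module ℂ E] [TopologicalSpace E]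
  [IsTopologicalAddGroup E] [ContinuousSMul ℂ E]

/-- The map `u ↦ (u ∘ e_γ)_γ`. -/
def restrictCLM : (X →L[ℂ] E) →L[ℂ] ∀ γ, Y γ →L[ℂ] E :=
  ContinuousLinearMap.pi fun γ => (e γ).precomp E

theorem restrictCLM_apply (u : X →L[ℂ] E) (γ : Γ) (y : Y γ) :
    restrictCLM e E u γ y = u (e γ y) := rfl

/-- On a bounded set `B`, the map `Φ v = ∑ v γ ∘ m γ` reconstructs `u` from its restrictions. As `Φ`
is continuous, smallness of the restrictions forces smallness of `u` on `B`. The map `Φ` depends on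
`B`, so this is not a global left inverse. -/
theorem isInducing_restrictCLM (h : ∀ B : Set X, Bornology.IsVonNBounded ℂ B →
    ∃ (s : Finset Γ) (m : ∀ γ, X →L[ℂ] Y γ), ∀ x ∈ B, ∑ γ ∈ s, e γ (m γ x) = x) :
    IsInducing (restrictCLM e E) := by
  refine IsTopologicalAddGroup.isInducing_iff_nhds_zero.2 (le_antisymm ?_ ?_)
  · exact Filter.map_le_iff_le_comap.1 ((restrictCLM e E).continuous.tendsto' 0 0 (map_zero _))
  · refine ContinuousLinearMap.hasBasis_nhds_zero.ge_iff.2 ?_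
    rintro ⟨B, N⟩ ⟨hB, hN⟩
    obtain ⟨s, m, hm⟩ := h B hB
    let Φ : (∀ γ, Y γ →L[ℂ] E) →L[ℂ] (X →L[ℂ] E) :=
      ∑ γ ∈ s, ((m γ).precomp E).comp (ContinuousLinearMap.proj γ)
    have hΦ : ∀ v x, Φ v x = ∑ γ ∈ s, v γ (m γ x) := fun v x => by
      simp [Φ]
    refine ⟨Φ ⁻¹' {w | ∀ x ∈ B, w x ∈ N}, Φ.continuous.tendsto' 0 0 (map_zero _)
        (ContinuousLinearMap.hasBasis_nhds_zero.mem_of_mem (i := (B, N)) ⟨hB, hN⟩), ?_⟩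
    intro u hu x hx
    have h1 := hu x hx
    rw [hΦ] at h1
    simp only [restrictCLM_apply] at h1
    rwa [← map_sum, hm x hx] at h1

/-- The range consists of the families `v` whose sum map `L v` on the direct sum kills the kernel of
`A`. This is an intersection of zero sets of continuous functions of `v`. -/
theorem isClosed_range_restrictCLM [∀ γ, ContinuousSMul ℂ (Y γ)] [T2Space E]
    (h : ∀ x : X, ∃ (s : Finset Γ) (y : ∀ γ, Y γ), ∑ γ ∈ s, e γ (y γ) = x)
    (hc : ∀ u : X →ₗ[ℂ] E, (∀ γ, Continuous fun y => u (e γ y)) → Continuous u) :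
    IsClosed (range (restrictCLM e E)) := by
  classical
  let A : (Π₀ γ, Y γ) →ₗ[ℂ] X := DFinsupp.lsum ℂ fun γ => (e γ).toLinearMap
  let L (v : ∀ γ, Y γ →L[ℂ] E) : (Π₀ γ, Y γ) →ₗ[ℂ] E := DFinsupp.lsum ℂ fun γ => (v γ).toLinearMap
  have hA : ∀ γ y, A (DFinsupp.single γ y) = e γ y := fun γ y => DFinsupp.lsum_single ..
  have hL : ∀ v γ y, L v (DFinsupp.single γ y) = v γ y := fun v γ y => DFinsupp.lsum_single ..
  have hsurj : Function.Surjective A := fun x => by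
    obtain ⟨s, y, rfl⟩ := h x
    exact ⟨∑ γ ∈ s, DFinsupp.single γ (y γ), by simp only [map_sum, hA]⟩
  -- Each `x` has finitely many nonzero components, so `L v x` is a finite sum of point evaluations
  -- of the `v γ`.
  have hLc : ∀ x, Continuous fun v => L v x := fun x => by
    induction x using DFinsupp.induction with
    | h0 => simpa only [map_zero] using continuous_const
    | ha γ y x _ _ ih =>
      simp only [map_add, hL]
      exact ((continuous_eval_const y).comp (continuous_apply γ)).add ih
  suffices range (restrictCLM e E) = ⋂ (x) (_ : A x = 0), {v | L v x = 0} by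
    rw [this]
    exact isClosed_iInter fun x => isClosed_iInter fun _ => isClosed_eq (hLc x) continuous_const
  refine Subset.antisymm ?_ fun v hv => ?_
  · rintro _ ⟨u, rfl⟩
    refine mem_iInter₂.2 fun x hx => ?_
    have h1 : L (restrictCLM e E u) = u.toLinearMap ∘ₗ A := by
      refine DFinsupp.lhom_ext fun γ y => ?_
      rw [hL, LinearMap.comp_apply, hA]
      rfl
    rw [mem_ofPred_eq, h1, LinearMap.comp_apply, hx, map_zero]
  -- Conversely, if `L v` kills the kernel of `A`, it factors through `A` algebraically, and `hc`
  -- gives continuity of the factor.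
  · obtain ⟨u, hu⟩ := exists_comp_eq_of_ker_le hsurj (L v) fun x => by
      exact mem_iInter₂.1 hv x
    have huv : ∀ γ y, u (e γ y) = v γ y := fun γ y => by rw [← hA, hu, hL]
    refine ⟨⟨u, hc u fun γ => ?_⟩, funext fun γ => ContinuousLinearMap.ext (huv γ)⟩
    simpa only [huv] using (v γ).continuous

end RestrictCLM

namespace FormalManifold

variable {M : FormalManifold.{u}}

/-! ### Restriction of generalized functions to the members of an open cover -/

theorem continuous_of_continuous_extDc (F : M.Mod) {E : Type*} [AddCommGroup E]
    [Module ℂ E] [TopologicalSpace E] [IsTopologicalAddGroup E] [ContinuousSMul ℂ E]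
    [LocallyConvexSpace ℝ E] {Γ : Type w} {U : Γ → Opens M.Pt} (hU : ⨆ γ, U γ = ⊤)
    (u : Dc F ⊤ →ₗ[ℂ] E) (h : ∀ γ, Continuous fun η => u (extDc F (U γ) η)) : Continuous u := by
  refine continuous_of_continuous_DKr u fun p => ?_
  obtain ⟨s, m, hm⟩ := exists_decomposition F hU p.2.1
  have h1 : Continuous fun η => ∑ γ ∈ s, u (extDc F (U γ) (m γ η)) :=
    continuous_finsetSum _ fun γ _ => (h γ).comp (m γ).continuous
  refine (h1.comp (continuous_inclusion_Dc F p)).congr ?_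
  rintro ⟨_, D, rfl⟩
  have h2 := hm ⟨D.1, DiffKr_le_DiffC F.val M.dens p D.2⟩
    (Submodule.inclusion (DKr_le_Dc F p) ⟨_, D, rfl⟩) D.2.2 rfl
  exact (map_sum u _ s).symm.trans (congrArg u h2)

theorem isClosedEmbedding_restrict_extDc {F : M.Mod} (hF : IsRegularLimit F) (E : Type v)
    [AddCommGroup E] [Module ℂ E] [TopologicalSpace E] [IsTopologicalAddGroup E]
    [ContinuousSMul ℂ E] [LocallyConvexSpace ℝ E] [T2Space E] {Γ : Type w} {U : Γ → Opens M.Pt}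
    (hU : ⨆ γ, U γ = ⊤) : IsClosedEmbedding (restrictCLM (fun γ => extDc F (U γ)) E) := by
  -- Injectivity follows from the inducing property, because the space of continuous linear maps
  -- into the Hausdorff space `E` is Hausdorff.
  refine ⟨(isInducing_restrictCLM _ E fun B hB => ?_).isEmbedding,
    isClosed_range_restrictCLM _ E ?_ fun u hu => continuous_of_continuous_extDc F hU u hu⟩
  -- Regularity supplies one compact set for all of `B`, hence one finite decomposition valid on
  -- `B`.
  · obtain ⟨p, B', -, rfl⟩ := hF.2 B hB
    obtain ⟨s, m, hm⟩ := exists_decomposition F hU p.2.1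
    refine ⟨s, m, ?_⟩
    rintro _ ⟨⟨_, D, rfl⟩, -, rfl⟩
    exact hm ⟨D.1, DiffKr_le_DiffC F.val M.dens p D.2⟩ _ D.2.2 rfl
  · rintro ⟨_, D, rfl⟩
    obtain ⟨K, hK, -, hDK⟩ := D.2.2
    obtain ⟨s, m, hm⟩ := exists_decomposition F hU hK
    exact ⟨s, fun γ => m γ ⟨_, D, rfl⟩, hm D ⟨_, D, rfl⟩ hDK rfl⟩

end FormalManifold

end FormalMfd

end

theorem mainTheorem6 (M : FormalMfd.FormalManifold.{u}) (F : M.Mod)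
    {E : Type v} [AddCommGroup E] [Module ℂ E] [UniformSpace E] [IsUniformAddGroup E]
    [ContinuousSMul ℂ E] [LocallyConvexSpace ℝ E] [T2Space E] [QuasiCompleteSpace ℂ E]
    (hF : FormalMfd.FormalManifold.IsRegularLimit F)
    {Γ : Type w} (U : Γ → TopologicalSpace.Opens M.Pt) (hU : ⨆ γ, U γ = ⊤) :
    ∃ R : FormalMfd.FormalManifold.GenFun F ⊤ E →L[ℂ]
        (∀ γ, FormalMfd.FormalManifold.GenFun F (U γ) E),
      (∀ (γ : Γ) (η : FormalMfd.FormalManifold.Dc F (U γ)),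
        ∃ η' : FormalMfd.FormalManifold.Dc F ⊤, FormalMfd.FormalManifold.IsExt η η' ∧
          ∀ u : FormalMfd.FormalManifold.GenFun F ⊤ E, R u γ η = u η') ∧
      Topology.IsClosedEmbedding R :=
  ⟨FormalMfd.restrictCLM (fun γ => FormalMfd.FormalManifold.extDc F (U γ)) E,
    fun γ η => ⟨FormalMfd.FormalManifold.extDc F (U γ) η,
      FormalMfd.FormalManifold.extDc_apply F η, fun _ => rfl⟩,
    FormalMfd.FormalManifold.isClosedEmbedding_restrict_extDc hF E hU⟩
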